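/- **Setting.** Let $\lambda>0$ (wavelength) and $r_0>0$, and let a continuous antenna array occupy the sphere $\mathbb{O}^2=\{A\in\mathbb{R}^3:|A|=r_0\}$. Users are located at $X_1,\dots,X_U\in\mathbb{R}^3$; put $r_u=|X_u|$ and $\varepsilon=\max_u r_u/r_0$. The channel between $X_u$ and $A\in\mathbb{O}^2$ is $$h_u(A)=\frac{1}{\sqrt{4\pi}\,|X_u-A|}\,e^{-j\frac{2\pi}{\lambda}|X_u-A|}.$$ User $u$ transmits a pilot sequence $\mathbf{s}_u=(s_u(1),\dots,s_u(L))\in\mathbb{C}^L$ with $L\ge U$, and the pilot sequences are orthogonal with unit norm: $\mathbf{s}_u^\dagger\mathbf{s}_k=\delta_{u,k}$. In slot $t$ the array receives $$q_t(A)=\frac{\lambda}{\sqrt{4\pi}}\sum_{u=1}^U h_u(A)\,s_u(t)+z_t(A),\qquad A\in\mathbb{O}^2,$$ where every $z_t(A)$ is $\mathcal{CN}(0,\sigma^2)$ and, for each $t$, $z_t(A)$ and $z_t(B)$ are independent whenever $A\ne B$. Let $Y_\ell^m(\varphi,\theta)$ ($\varphi$ azimuth, $\theta$ polar angle, $\ell\ge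 0$, $|m|\le\ell$) be the orthonormal spherical harmonics. The Laplace coefficients of $q_t$ are $$Q_\ell^m(t)=\int_0^{2\pi}\!\!\int_0^\pi q_t(\varphi,\theta)\,Y_\ell^m(\varphi,\theta)\sin\theta\,d\theta\,d\varphi,$$ where the integral is the limit as $N\to\infty$ of the Riemann sums over the grid $\varphi=2\pi a/N$, $\theta=\pi b/N$, $0\le a,b<N$. For a location $Y\in\mathbb{R}^3$ with spherical coordinates $(r_Y,\varphi_Y,\theta_Y)$ let $$V_\ell^m(Y)=(2\pi)^{3/2}\,\frac{j^\ell J_{\ell+1/2}(2\pi r_Y/\lambda)}{(2\pi r_Y/\lambda)^{1/2}}\,Y_\ell^m(\varphi_Y,\theta_Y)$$ (extended by continuity to $Y=0$), where $J_\nu$ is the Bessel function of the first kind. The channel observation profile of user $u$ is $$\tilde\Phi_u(Y)=\frac{r_0}{\lambda}\Big|\sum_{\ell=0}^\infty\sum_{m=-\ell}^{\ell}\big[V_\ell^m(Y)\big]^*\sum_{t=1}^L s_u^*(t)\,Q_\ell^m(t)\Big| .$$ Let $\mathrm{sinc}(x)=\sin(x)/x$, $\mathrm{sinc}(0)=1$.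 **Corollary (effect of pilot sequences, spherical array).** For every $\kappa$ there are constants $C,\delta>0$, depending only on $\kappa$, such that in the above setting, whenever $r_u\le\kappa\lambda$ for all $u$ and $\varepsilon\le\delta$, the following holds almost surely. All the Laplace coefficients $Q_\ell^m(t)$ exist, and for every user $u$: 1. for every $Y\in\mathbb{R}^3$ the series over $\ell$ defining $\tilde\Phi_u(Y)$ converges absolutely, and $$\Big|\tilde\Phi_u(Y)-\big|\mathrm{sinc}\big(\tfrac{2\pi}{\lambda}|X_u-Y|\big)\big|\Big|\le C\,\varepsilon ;$$ 2. location estimation by detection of the peak of the profile is almost perfect: $\tilde\Phi_u$ attains its maximum over $\mathbb{R}^3$, and every $Z$ with $\tilde\Phi_u(Z)\ge\tilde\Phi_u(X_u)$, in particular every maximum point, satisfies $|Z-X_u|\le C\lambda\sqrt{\varepsilon}$. -/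

import Mathlib

open MeasureTheory ProbabilityTheory Filter Topology

/-! ### Geometry -/

/-- Physical space `ℝ³` with the Euclidean norm. -/
abbrev Space3 : Type := EuclideanSpace ℝ (Fin 3)

/-- The point with spherical coordinates: radius `r`, azimuth `φ`, polar angle `θ`. -/
noncomputable def sphPoint (r φ θ : ℝ) : Space3 :=
  !₂[r * (Real.sin θ * Real.cos φ), r * (Real.sin θ * Real.sin φ), r * Real.cos θ]

/-- Azimuth angle of a point of `ℝ³`. -/
noncomputable def azimuth (Y : Space3) : ℝ := Complex.arg ((Y 0 : ℂ) + (Y 1 : ℂ) * Complex.I)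

/-- Polar angle of a point of `ℝ³`. -/
noncomputable def polarAngle (Y : Space3) : ℝ := Real.arccos (Y 2 / ‖Y‖)

/-! ### Special functions -/

/-- The Bessel function of the first kind of real order `ν`, at a real argument `x ≥ 0`. -/
noncomputable def besselJ (ν x : ℝ) : ℝ :=
  ∑' i : ℕ, (-1) ^ i / ((i.factorial : ℝ) * Real.Gamma (i + ν + 1)) * (x / 2) ^ (2 * (i : ℝ) + ν)

/-- The function `J_{ℓ+1/2}(x) / √x`, extended by continuity to `x = 0`. -/
noncomputable def besselRadial (ℓ : ℕ) (x : ℝ) : ℝ :=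
  if x = 0 then (if ℓ = 0 then √(2 / Real.pi) else 0)
  else besselJ (ℓ + 1 / 2) x / √x

/-- The associated Legendre function `P_ℓ^m` on `[-1, 1]`, `-ℓ ≤ m ≤ ℓ`:
`(-1)^m / (2^ℓ ℓ!) * (1 - x²)^(m/2) * (d/dx)^(ℓ+m) (x² - 1)^ℓ`.
(For `m < 0` and `x = ±1` the real power is `0`, which is the value by continuity.) -/
noncomputable def assocLegendre (ℓ : ℕ) (m : ℤ) (x : ℝ) : ℝ :=
  (-1) ^ m / (2 ^ ℓ * (ℓ.factorial : ℝ)) * (1 - x ^ 2) ^ ((m : ℝ) / 2) *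
    (Polynomial.derivative^[((ℓ : ℤ) + m).toNat]
      ((Polynomial.X ^ 2 - 1 : Polynomial ℝ) ^ ℓ)).eval x

/-- The orthonormal spherical harmonic `Y_ℓ^m` at azimuth `φ` and polar angle `θ`,
for `-ℓ ≤ m ≤ ℓ`. -/
noncomputable def sphHarm (ℓ : ℕ) (m : ℤ) (φ θ : ℝ) : ℂ :=
  ((√((2 * (ℓ : ℝ) + 1) / (4 * Real.pi) *
      ((((ℓ : ℤ) - m).toNat.factorial : ℝ) / (((ℓ : ℤ) + m).toNat.factorial : ℝ))) *
    assocLegendre ℓ m (Real.cos θ) : ℝ) : ℂ) * Complex.exp (Complex.I * (m : ℂ) * (φ : ℂ))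

/-! ### Channel, noise and training signals -/

/-- The free-space response of the channel between the locations `X` and `A`, at wavelength
`lam`. -/
noncomputable def channel (lam : ℝ) (X A : Space3) : ℂ :=
  ((1 / (√(4 * Real.pi) * dist X A) : ℝ) : ℂ) *
    Complex.exp (-Complex.I * ((2 * Real.pi / lam * dist X A : ℝ) : ℂ))

/-- The circularly symmetric complex Gaussian law `CN(0, σ²)`. -/
noncomputable def complexNormal (σ2 : NNReal) : Measure ℂ :=
  ((gaussianReal 0 (σ2 / 2)).prod (gaussianReal 0 (σ2 / 2))).map
    (fun p : ℝ × ℝ => (p.1 : ℂ) + (p.2 : ℂ) * Complex.I)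

/-- Spatially white Gaussian noise on the sphere of radius `r0`: every sample is `CN(0, σ²)`, and
the samples at two different locations are independent. -/
structure IsSpatiallyWhite {Ω : Type*} [MeasurableSpace Ω] (P : Measure Ω) (r0 : ℝ) (σ2 : NNReal)
    (z : Space3 → Ω → ℂ) : Prop where
  law : ∀ A ∈ Metric.sphere (0 : Space3) r0, HasLaw (z A) (complexNormal σ2) P
  indep : ∀ A ∈ Metric.sphere (0 : Space3) r0, ∀ B ∈ Metric.sphere (0 : Space3) r0,
    A ≠ B → IndepFun (z A) (z B) P

/-- The signal received at the array element `A` when the users at `X` send the symbols `s`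
and the noise sample at `A` is `z A`; the aperture factor of an element is `lam / √(4π)`. -/
noncomputable def trainingSignal (lam : ℝ) {U : ℕ} (X : Fin U → Space3) (s : Fin U → ℂ)
    (z : Space3 → ℂ) (A : Space3) : ℂ :=
  ((lam / √(4 * Real.pi) : ℝ) : ℂ) * ∑ u, channel lam (X u) A * s u + z A

/-- Riemann sum, on the uniform `N × N` grid, for the integral
`∫_0^{2π} ∫_0^π F(φ, θ) sin θ dθ dφ` over the unit sphere. -/
noncomputable def sphereRiemannSum (F : ℝ → ℝ → ℂ) (N : ℕ) : ℂ :=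
  ∑ a ∈ Finset.range N, ∑ b ∈ Finset.range N,
    F (2 * Real.pi * a / N) (Real.pi * b / N) *
      ((Real.sin (Real.pi * b / N) * (2 * Real.pi / N) * (Real.pi / N) : ℝ) : ℂ)

/-- The integrand `q(φ, θ) Y_ℓ^m(φ, θ)` of a Laplace coefficient of a signal `q` on the sphere of
radius `r0`. -/
noncomputable def laplaceIntegrand (r0 : ℝ) (q : Space3 → ℂ) (ℓ : ℕ) (m : ℤ) (φ θ : ℝ) : ℂ :=
  q (sphPoint r0 φ θ) * sphHarm ℓ m φ θ

/-- The Laplace coefficient `Q_ℓ^m = ∫_0^{2π} ∫_0^π q(φ, θ) Y_ℓ^m(φ, θ) sin θ dθ dφ`. Since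
the paths of spatially white noise are not measurable, the integral is the limit of the Riemann
sums over uniform grids. -/
noncomputable def laplaceCoeff (r0 : ℝ) (q : Space3 → ℂ) (ℓ : ℕ) (m : ℤ) : ℂ :=
  limUnder atTop (sphereRiemannSum (laplaceIntegrand r0 q ℓ m))

/-! ### The channel observation profile -/

/-- The location signature
`V_ℓ^m(Y) = (2π)^{3/2} j^ℓ J_{ℓ+1/2}(2π r_Y / lam) (2π r_Y / lam)^{-1/2} Y_ℓ^m(φ_Y, θ_Y)`. -/
noncomputable def locSignature (lam : ℝ) (Y : Space3) (ℓ : ℕ) (m : ℤ) : ℂ :=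
  (((2 * Real.pi) ^ (3 / 2 : ℝ) * besselRadial ℓ (2 * Real.pi / lam * ‖Y‖) : ℝ) : ℂ) *
    Complex.I ^ ℓ * sphHarm ℓ m (azimuth Y) (polarAngle Y)

/-- The combination `Q_u = ∑ₜ conj (s_u t) Q(t)` of the Laplace coefficients of the signals
`q t`, `t = 1, …, L`, with the pilot sequence `su` of one user. -/
noncomputable def combinedCoeff {L : ℕ} (r0 : ℝ) (su : EuclideanSpace ℂ (Fin L))
    (q : Fin L → Space3 → ℂ) (ℓ : ℕ) (m : ℤ) : ℂ :=
  ∑ t, star (su t) * laplaceCoeff r0 (q t) ℓ m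

/-- The degree-`ℓ` part of the product `V(Y) ∘ Q = ∑_ℓ ∑_{|m| ≤ ℓ} conj (V_ℓ^m(Y)) Q_ℓ^m`. -/
noncomputable def profileTerm (lam : ℝ) (Y : Space3) (Q : ℕ → ℤ → ℂ) (ℓ : ℕ) : ℂ :=
  ∑ m ∈ Finset.Icc (-(ℓ : ℤ)) ℓ, star (locSignature lam Y ℓ m) * Q ℓ m

/-- The channel observation profile `(r0 / lam) |V(Y) ∘ Q|` of the coefficients `Q`. -/
noncomputable def profile (lam r0 : ℝ) (Q : ℕ → ℤ → ℂ) (Y : Space3) : ℝ :=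
  r0 / lam * ‖∑' ℓ : ℕ, profileTerm lam Y Q ℓ‖

/-! ### Riemann sums on uniform grids -/

/-! Noise disappears entirely from the Laplace coefficients. On the `N × N` grid the noise enters a
Riemann sum as about `N²` pairwise independent centered terms with weights `O(N⁻²)`. The second
moment of that sum is therefore `O(N⁻²)`, which is summable, so the sum tends to `0` almost surely
(`ae_tendsto_sphereRiemannSum_noise`). The channel part is continuous and converges to an ordinary
integral. Orthonormal pilots then isolate one user exactly (`combinedCoeff_training`).

The profile is next put in closed form. By the addition theorem, the sum over `m` of `conj Y_ℓ^m(Y)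
Y_ℓ^m(p)` is a zonal kernel in the cosine of the angle, and the plane wave expansion sums these
kernels against the Bessel factors to `exp(-i k ⟨Y, n⟩)`, with `k = 2π/λ` and `n` the direction of
`p`. So the series is the correlation over the sphere of the near field of `X` with a plane wave
(`hasSum_profileTerm`). The addition theorem is used only as a recurrence: harmonics of degree `ℓ`
are coefficients of the `ℓ`-th power of a quadratic polynomial, the zonal kernel is the apolar
pairing of two such powers, and adjointness of multiplication and differentiation gives the Legendre
recurrence (`zonalKernel_add_two`). Any sequence obeying that recurrence has a plane wave expansion
(`hasSum_planeWave`).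

Finally, the near field is within `O(ε)` of `exp(-i k (r₀ - ⟨X, n⟩))` (`norm_farField_sub_le`). The
correlation thus becomes, up to a phase and `O(ε)`, the spherical mean of `exp(-i k ⟨Y - X, n⟩)`,
which is `sinc(k |X - Y|)`. Since `|sinc x|` lies below `1 - x²/40` on `[0, 2]` and below `1/2`
beyond, an `O(ε)` perturbation moves the peak by at most `O(λ √ε)`. -/

theorem norm_riemannSum_sub_integral_le (g : ℝ → ℂ) (hg : Continuous g) (T e : ℝ) (hT : 0 ≤ T)
    (N : ℕ) (hN : 0 < N)
    (h : ∀ x ∈ Set.Icc 0 T, ∀ y ∈ Set.Icc 0 T, |x - y| ≤ T / N → ‖g x - g y‖ ≤ e) :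
    ‖∑ b ∈ Finset.range N, g (T * b / N) * ((T / N : ℝ) : ℂ) - ∫ y in (0 : ℝ)..T, g y‖ ≤ T * e := by
  have hN' : (0 : ℝ) < N := by exact_mod_cast hN
  have hTN : 0 ≤ T / N := by positivity
  have hsum := intervalIntegral.sum_integral_adjacent_intervals (f := g) (μ := volume)
    (a := fun k : ℕ => T * k / N) (n := N) (fun k _ => hg.intervalIntegrable _ _)
  simp only [Nat.cast_zero, mul_zero, zero_div, mul_div_cancel_right₀ _ hN'.ne'] at hsum
  rw [← hsum, ← Finset.sum_sub_distrib]
  refine (norm_sum_le_of_le _ (f := fun b => _) (n := fun _ => e * (T / N)) fun b hb => ?_).trans ?_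
  · have hb' : (b : ℝ) + 1 ≤ N := by exact_mod_cast Finset.mem_range.mp hb
    have hlen : T * ((b + 1 : ℕ) : ℝ) / N - T * b / N = T / N := by push_cast; ring
    have hlo : 0 ≤ T * b / N := by positivity
    have hhi : T * ((b + 1 : ℕ) : ℝ) / N ≤ T := by
      rw [div_le_iff₀ hN']; push_cast; gcongr
    have hconst : g (T * b / N) * ((T / N : ℝ) : ℂ) =
        ∫ _ in (T * b / N)..(T * ((b + 1 : ℕ) : ℝ) / N), g (T * b / N) := by
      rw [intervalIntegral.integral_const, hlen, Complex.real_smul, mul_comm]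
    rw [hconst, ← intervalIntegral.integral_sub (by simp) (hg.intervalIntegrable _ _)]
    refine (intervalIntegral.norm_integral_le_of_norm_le_const (C := e) fun y hy => ?_).trans
      (le_of_eq ?_)
    · rw [Set.uIoc_of_le (by linarith)] at hy
      refine h _ ⟨hlo, by linarith⟩ _ ⟨by linarith [hy.1], hy.2.trans hhi⟩ ?_
      rw [abs_sub_comm, abs_of_nonneg (by linarith [hy.1])]
      linarith [hy.2]
    · rw [hlen, abs_of_nonneg hTN]
  · rw [Finset.sum_const, Finset.card_range, nsmul_eq_mul]
    apply le_of_eq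
    field_simp

theorem tendsto_riemannSum_iterated (G : ℝ → ℝ → ℂ) (hG : Continuous (Function.uncurry G))
    (S T : ℝ) (hS : 0 ≤ S) (hT : 0 ≤ T) :
    Tendsto (fun N : ℕ => ∑ a ∈ Finset.range N, ∑ b ∈ Finset.range N,
      G (S * a / N) (T * b / N) * ((S / N : ℝ) : ℂ) * ((T / N : ℝ) : ℂ)) atTop
      (𝓝 (∫ x in (0 : ℝ)..S, ∫ y in (0 : ℝ)..T, G x y)) := by
  have hI : Continuous fun x => ∫ y in (0 : ℝ)..T, G x y :=
    intervalIntegral.continuous_parametric_intervalIntegral_of_continuous' hG 0 T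
  have huc := (isCompact_Icc (a := (0 : ℝ)) (b := S)).prod (isCompact_Icc (a := (0 : ℝ)) (b := T))
    |>.uniformContinuousOn_of_continuous hG.continuousOn
  rw [Metric.uniformContinuousOn_iff] at huc
  rw [Metric.tendsto_atTop]
  intro ε hε
  -- The inner and outer sums each cost `S * T * e`, hence the factor `2`; the `+ 1` keeps the
  -- denominator positive when `S * T = 0`.
  set e := ε / (2 * (S * T + 1)) with he
  have he0 : 0 < e := by positivity
  obtain ⟨d, hd, hdd⟩ := huc e he0
  obtain ⟨N₀, hN₀⟩ := exists_nat_gt ((S + T) / d)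
  refine ⟨N₀ + 1, fun N hN => ?_⟩
  have hNpos : 0 < N := by omega
  have hN' : (0 : ℝ) < N := by exact_mod_cast hNpos
  have hNd : (S + T) / N < d := by
    rw [div_lt_iff₀ hN']
    rw [div_lt_iff₀ hd] at hN₀
    have : (N₀ : ℝ) ≤ N := by exact_mod_cast (by omega : N₀ ≤ N)
    nlinarith
  have hSd : S / N < d := lt_of_le_of_lt (by gcongr; linarith) hNd
  have hTd : T / N < d := lt_of_le_of_lt (by gcongr; linarith) hNd
  have h1 : ∀ x ∈ Set.Icc 0 S, ∀ y ∈ Set.Icc 0 T, ∀ x' ∈ Set.Icc 0 S, ∀ y' ∈ Set.Icc 0 T,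
      |x - x'| ≤ S / N → |y - y'| ≤ T / N → ‖G x y - G x' y'‖ ≤ e := by
    intro x hx y hy x' hx' y' hy' h h'
    have := hdd (x, y) ⟨hx, hy⟩ (x', y') ⟨hx', hy'⟩ (by
      rw [Prod.dist_eq, Real.dist_eq, Real.dist_eq]
      exact max_lt (h.trans_lt hSd) (h'.trans_lt hTd))
    rw [dist_eq_norm] at this
    exact this.le
  have hmem : ∀ a ∈ Finset.range N, S * a / N ∈ Set.Icc 0 S := fun a ha => by
    have : (a : ℝ) ≤ N := by exact_mod_cast (Finset.mem_range.mp ha).le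
    refine ⟨by positivity, ?_⟩
    rw [div_le_iff₀ hN']
    gcongr
  have hinner : ∀ x ∈ Set.Icc 0 S, ‖∑ b ∈ Finset.range N, G x (T * b / N) * ((T / N : ℝ) : ℂ) -
      ∫ y in (0 : ℝ)..T, G x y‖ ≤ T * e := fun x hx =>
    norm_riemannSum_sub_integral_le _ (hG.comp (Continuous.prodMk_right x)) T e hT N hNpos
      fun y hy y' hy' h => h1 x hx y hy x hx y' hy' (by rw [sub_self, abs_zero]; positivity) h
  have houter : ‖∑ a ∈ Finset.range N, (∫ y in (0 : ℝ)..T, G (S * a / N) y) * ((S / N : ℝ) : ℂ) -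
      ∫ x in (0 : ℝ)..S, ∫ y in (0 : ℝ)..T, G x y‖ ≤ S * (T * e) := by
    refine norm_riemannSum_sub_integral_le _ hI S (T * e) hS N hNpos fun x hx x' hx' h => ?_
    have hc : ∀ x, Continuous fun y => G x y := fun x => hG.comp (Continuous.prodMk_right x)
    rw [← intervalIntegral.integral_sub ((hc x).intervalIntegrable _ _)
      ((hc x').intervalIntegrable _ _)]
    refine (intervalIntegral.norm_integral_le_of_norm_le_const (C := e) fun y hy => ?_).trans
      (le_of_eq ?_)
    · rw [Set.uIoc_of_le hT] at hy
      have hy' : y ∈ Set.Icc 0 T := ⟨hy.1.le, hy.2⟩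
      exact h1 x hx y hy' x' hx' y hy' h (by rw [sub_self, abs_zero]; positivity)
    · rw [sub_zero, abs_of_nonneg hT, mul_comm]
  have hdiff : ‖∑ a ∈ Finset.range N, ∑ b ∈ Finset.range N,
      G (S * a / N) (T * b / N) * ((S / N : ℝ) : ℂ) * ((T / N : ℝ) : ℂ) -
      ∑ a ∈ Finset.range N, (∫ y in (0 : ℝ)..T, G (S * a / N) y) * ((S / N : ℝ) : ℂ)‖ ≤
        S * (T * e) := by
    rw [← Finset.sum_sub_distrib]
    refine (norm_sum_le_of_le _ (f := fun b => _) (n := fun _ => T * e * (S / N))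
      fun a ha => ?_).trans ?_
    · have : ∑ b ∈ Finset.range N, G (S * a / N) (T * b / N) * ((S / N : ℝ) : ℂ) *
          ((T / N : ℝ) : ℂ) - (∫ y in (0 : ℝ)..T, G (S * a / N) y) * ((S / N : ℝ) : ℂ) =
          (∑ b ∈ Finset.range N, G (S * a / N) (T * b / N) * ((T / N : ℝ) : ℂ) -
            ∫ y in (0 : ℝ)..T, G (S * a / N) y) * ((S / N : ℝ) : ℂ) := by
        rw [sub_mul, Finset.sum_mul]
        congr 1
        exact Finset.sum_congr rfl fun b _ => by ring
      rw [this, norm_mul, Complex.norm_real, Real.norm_of_nonneg (by positivity)]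
      gcongr
      exact hinner _ (hmem a ha)
    · rw [Finset.sum_const, Finset.card_range, nsmul_eq_mul]
      apply le_of_eq
      field_simp
  rw [dist_eq_norm]
  calc _ ≤ S * (T * e) + S * (T * e) := (norm_sub_le_norm_sub_add_norm_sub _ _ _).trans
        (add_le_add hdiff houter)
    _ < ε := by
      rw [he]
      have : S * T / (S * T + 1) < 1 := by rw [div_lt_one (by positivity)]; linarith
      calc _ = ε * (S * T / (S * T + 1)) := by field_simp; ring
        _ < ε := by nlinarith

/-- The Riemann sums over the angular grids of a continuous integrand converge. -/
theorem tendsto_sphereRiemannSum (F G : ℝ → ℝ → ℂ) (hG : Continuous (Function.uncurry G))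
    (hFG : ∀ φ, ∀ θ ∈ Set.Icc 0 Real.pi, F φ θ = G φ θ) :
    Tendsto (sphereRiemannSum F) atTop
      (𝓝 (∫ φ in (0 : ℝ)..(2 * Real.pi), ∫ θ in (0 : ℝ)..Real.pi, G φ θ * (Real.sin θ : ℂ))) := by
  have hc : Continuous (Function.uncurry fun φ θ => G φ θ * (Real.sin θ : ℂ)) := by
    have : Continuous fun p : ℝ × ℝ => (Real.sin p.2 : ℂ) := by fun_prop
    exact hG.mul this
  refine (tendsto_riemannSum_iterated _ hc (2 * Real.pi) Real.pi Real.two_pi_pos.le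
    Real.pi_pos.le).congr fun N => ?_
  refine Finset.sum_congr rfl fun a _ => Finset.sum_congr rfl fun b hb => ?_
  have hb' : (b : ℝ) ≤ N := by exact_mod_cast (Finset.mem_range.mp hb).le
  have hN : (0 : ℝ) < N := by
    exact_mod_cast lt_of_le_of_lt (Nat.zero_le _) (Finset.mem_range.mp hb)
  rw [hFG]
  · push_cast; ring
  · refine ⟨by positivity, ?_⟩
    rw [div_le_iff₀ hN]
    gcongr

/-! ### Spatially white noise has vanishing Laplace coefficients -/

theorem memLp_id_complexNormal (σ2 : NNReal) : MemLp id 2 (complexNormal σ2) := by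
  have hm : Measurable fun p : ℝ × ℝ => (p.1 : ℂ) + (p.2 : ℂ) * Complex.I := by fun_prop
  rw [complexNormal, memLp_map_measure_iff aestronglyMeasurable_id hm.aemeasurable]
  have hg : MemLp (fun x : ℝ => (x : ℂ)) 2 (gaussianReal 0 (σ2 / 2)) :=
    (memLp_id_gaussianReal 2).ofReal
  exact (hg.comp_fst _).add ((hg.comp_snd _).mul_const Complex.I)

theorem integral_id_complexNormal (σ2 : NNReal) : ∫ w, w ∂(complexNormal σ2) = 0 := by
  have hm : Measurable fun p : ℝ × ℝ => (p.1 : ℂ) + (p.2 : ℂ) * Complex.I := by fun_prop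
  have hg : Integrable (fun x : ℝ => (x : ℂ)) (gaussianReal 0 (σ2 / 2)) :=
    ((memLp_id_gaussianReal (μ := 0) (v := σ2 / 2) 1).integrable le_rfl).ofReal
  have h0 : ∫ x : ℝ, (x : ℂ) ∂(gaussianReal 0 (σ2 / 2)) = 0 := by
    rw [integral_complex_ofReal, integral_id_gaussianReal]; simp
  rw [complexNormal, integral_map hm.aemeasurable (f := fun w => w) aestronglyMeasurable_id,
    integral_add (hg.comp_fst _) ((hg.comp_snd _).mul_const Complex.I),
    integral_mul_const, integral_fun_fst (f := fun x : ℝ => (x : ℂ)),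
    integral_fun_snd (f := fun x : ℝ => (x : ℂ)), h0]
  simp

/-- A linear combination of pairwise independent centered square-integrable variables has second
moment bounded by the sum of the squared coefficients. -/
theorem lintegral_sq_sum_le {Ω ι : Type*} [MeasurableSpace Ω] (P : Measure Ω)
    [IsProbabilityMeasure P] (ν : Measure ℂ) (hν : MemLp id 2 ν) (hν0 : ∫ w, w ∂ν = 0)
    (L : ℂ →L[ℝ] ℝ) (hL : ∀ w, |L w| ≤ ‖w‖) (S : Finset ι) (Z : ι → Ω → ℂ) (w : ι → ℂ)
    (hZ : ∀ i ∈ S, HasLaw (Z i) ν P)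
    (hind : ∀ i ∈ S, ∀ j ∈ S, i ≠ j → IndepFun (Z i) (Z j) P) :
    ∫⁻ ω, ENNReal.ofReal ((L (∑ i ∈ S, Z i ω * w i)) ^ 2) ∂P ≤
      ENNReal.ofReal ((∫ v, ‖v‖ ^ 2 ∂ν) * ∑ i ∈ S, ‖w i‖ ^ 2) := by
  have hmem : ∀ i ∈ S, MemLp (Z i) 2 P := fun i hi => by
    have := (hZ i hi).map_eq ▸ hν
    exact (memLp_map_measure_iff aestronglyMeasurable_id (hZ i hi).aemeasurable).mp this
  set X : ι → Ω → ℝ := fun i ω => L (Z i ω * w i) with hX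
  have hX2 : ∀ i ∈ S, MemLp (X i) 2 P := fun i hi =>
    L.comp_memLp' ((hmem i hi).mul_const (w i))
  have hmean : ∀ i ∈ S, ∫ ω, X i ω ∂P = 0 := fun i hi => by
    have hint : Integrable (fun ω => Z i ω * w i) P :=
      ((hmem i hi).mul_const (w i)).integrable (by norm_num)
    rw [hX, L.integral_comp_comm hint, integral_mul_const]
    have : ∫ ω, Z i ω ∂P = ∫ v, v ∂ν := (hZ i hi).integral_eq
    rw [this, hν0, zero_mul, map_zero]
  -- Variances add under pairwise independence; no joint independence is needed.
  have hvar := IndepFun.variance_sum hX2 (fun i hi j hj hij => by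
    have hm : ∀ i, Measurable fun v : ℂ => L (v * w i) := fun i => by fun_prop
    exact (hind i hi j hj hij).comp (hm i) (hm j))
  have hsum : ∀ ω, L (∑ i ∈ S, Z i ω * w i) = (∑ i ∈ S, X i) ω := fun ω => by
    rw [map_sum, Finset.sum_apply]
  have hmem' : MemLp (∑ i ∈ S, X i) 2 P := memLp_finsetSum' S hX2
  have hmean' : ∫ ω, (∑ i ∈ S, X i) ω ∂P = 0 := by
    simp only [Finset.sum_apply]
    rw [integral_finsetSum _ fun i hi => (hX2 i hi).integrable (by norm_num)]
    exact Finset.sum_eq_zero hmean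
  have h1 : ∫⁻ ω, ENNReal.ofReal ((L (∑ i ∈ S, Z i ω * w i)) ^ 2) ∂P =
      ENNReal.ofReal (Var[∑ i ∈ S, X i; P]) := by
    rw [hmem'.ofReal_variance_eq, evariance_eq_lintegral_ofReal, hmean']
    simp only [hsum, sub_zero]
  rw [h1, hvar, Finset.mul_sum]
  refine ENNReal.ofReal_le_ofReal (Finset.sum_le_sum fun i hi => ?_)
  have hnorm : ∫ v, ‖v‖ ^ 2 ∂ν = ∫ ω, ‖Z i ω‖ ^ 2 ∂P :=
    ((hZ i hi).integral_comp (f := fun v : ℂ => ‖v‖ ^ 2)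
      (Continuous.aestronglyMeasurable (by fun_prop))).symm
  rw [variance_of_integral_eq_zero (hX2 i hi).aemeasurable (hmean i hi), hnorm,
    ← integral_mul_const]
  refine integral_mono (hX2 i hi).integrable_sq ((hmem i hi).integrable_norm_pow (by norm_num) |>.mul_const _)
    fun ω => ?_
  simp only [hX]
  rw [← sq_abs, ← mul_pow, ← norm_mul]
  gcongr
  exact hL _

/-- Summable second moments make `∑ X_N²` integrable, hence finite almost everywhere, so its terms
tend to `0`. Nothing is required of the dependence between different `N`. -/
theorem ae_tendsto_zero_of_lintegral_sq_le {Ω : Type*} [MeasurableSpace Ω] (P : Measure Ω)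
    (X : ℕ → Ω → ℝ) (hX : ∀ N, AEMeasurable (X N) P) (K : ℝ)
    (h : ∀ N, ∫⁻ ω, ENNReal.ofReal (X N ω ^ 2) ∂P ≤ ENNReal.ofReal (K * (1 / (N : ℝ) ^ 2))) :
    ∀ᵐ ω ∂P, Tendsto (fun N => X N ω) atTop (𝓝 0) := by
  have hfin : ∫⁻ ω, ∑' N, ENNReal.ofReal (X N ω ^ 2) ∂P ≠ ⊤ := by
    rw [lintegral_tsum fun N => ((hX N).pow_const 2).ennreal_ofReal]
    refine ne_top_of_le_ne_top ?_ (ENNReal.tsum_le_tsum h)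
    have hs : Summable fun N : ℕ => K * (1 / (N : ℝ) ^ 2) :=
      (Real.summable_one_div_nat_pow.mpr one_lt_two).mul_left K
    exact hs.tsum_ofReal_ne_top
  filter_upwards [ae_lt_top' (AEMeasurable.tsum
    fun N => ((hX N).pow_const 2).ennreal_ofReal) hfin] with ω hω
  have h1 := ENNReal.tendsto_atTop_zero_of_tsum_ne_top hω.ne
  have h2 : Tendsto (fun N => X N ω ^ 2) atTop (𝓝 0) := by
    have := (ENNReal.tendsto_toReal ENNReal.zero_ne_top).comp h1
    simpa [Function.comp_def, ENNReal.toReal_ofReal (sq_nonneg _)] using this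
  have h3 := (Real.continuous_sqrt.tendsto 0).comp h2
  rw [Real.sqrt_zero] at h3
  refine (tendsto_zero_iff_abs_tendsto_zero _).mpr ?_
  simpa [Function.comp_def, Real.sqrt_sq_eq_abs] using h3

theorem norm_sphPoint (r φ θ : ℝ) (hr : 0 ≤ r) : ‖sphPoint r φ θ‖ = r := by
  rw [EuclideanSpace.norm_eq, Fin.sum_univ_three]
  simp only [sphPoint, Real.norm_eq_abs, sq_abs]
  refine (congrArg Real.sqrt ?_).trans (Real.sqrt_sq hr)
  simp
  have h2 := Real.cos_sq_add_sin_sq θ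
  have h3 := Real.cos_sq_add_sin_sq φ
  linear_combination r ^ 2 * Real.sin θ ^ 2 * h3 + r ^ 2 * h2

/-- The cosine is injective on `[0, π]`, so the height determines `b`. Away from the pole the sine
is nonzero, so the azimuth is determined modulo `2π`, and `|a - a'| < N` leaves only `a = a'`. -/
theorem sphPoint_grid_injective (r : ℝ) (hr : 0 < r) (N a b a' b' : ℕ) (ha : a < N) (hb : b < N)
    (ha' : a' < N) (hb' : b' < N) (hb0 : 0 < b)
    (h : sphPoint r (2 * Real.pi * a / N) (Real.pi * b / N) =
      sphPoint r (2 * Real.pi * a' / N) (Real.pi * b' / N)) : a = a' ∧ b = b' := by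
  have hN : (0 : ℝ) < N := by exact_mod_cast lt_of_le_of_lt (Nat.zero_le _) ha
  have hpi := Real.pi_pos
  have h0 := congrArg (fun v : Space3 => v 0) h
  have h1 := congrArg (fun v : Space3 => v 1) h
  have h2 := congrArg (fun v : Space3 => v 2) h
  simp [sphPoint, hr.ne'] at h0 h1 h2
  have hmem : ∀ k : ℕ, k < N → Real.pi * k / N ∈ Set.Icc 0 Real.pi := fun k hk => by
    have : (k : ℝ) ≤ N := by exact_mod_cast hk.le
    refine ⟨by positivity, ?_⟩
    rw [div_le_iff₀ hN]; gcongr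
  have hbb := Real.injOn_cos (hmem b hb) (hmem b' hb') h2
  have hb_eq : b = b' := by
    have : (b : ℝ) = b' := by field_simp at hbb; exact hbb
    exact_mod_cast this
  refine ⟨?_, hb_eq⟩
  subst hb_eq
  have hsin : Real.sin (Real.pi * b / N) ≠ 0 := by
    have hbR : (0 : ℝ) < b := by exact_mod_cast hb0
    have : (b : ℝ) < N := by exact_mod_cast hb
    refine (Real.sin_pos_of_pos_of_lt_pi (by positivity) ?_).ne'
    rw [div_lt_iff₀ hN]; gcongr
  simp [hsin] at h0 h1
  have hang : ((2 * Real.pi * a / N : ℝ) : Real.Angle) = ((2 * Real.pi * a' / N : ℝ) : Real.Angle) :=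
    Real.Angle.cos_sin_inj h0 h1
  rw [Real.Angle.angle_eq_iff_two_pi_dvd_sub] at hang
  obtain ⟨k, hk⟩ := hang
  have hk' : ((a : ℤ) - a' : ℤ) = N * k := by
    have : (a : ℝ) - a' = N * k := by field_simp at hk; linarith
    exact_mod_cast this
  have hk0 : k = 0 := by
    by_contra hne
    have : (N : ℤ) ≤ |(a : ℤ) - a'| := by
      rw [hk', abs_mul, Nat.abs_cast]
      exact le_mul_of_one_le_right (by positivity) (Int.one_le_abs hne)
    have : |(a : ℤ) - a'| < N := by rw [abs_lt]; omega
    omega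
  rw [hk0, mul_zero] at hk'
  omega

theorem ae_tendsto_sphereRiemannSum_noise {Ω : Type*} [MeasurableSpace Ω] (P : Measure Ω)
    [IsProbabilityMeasure P] (r0 : ℝ) (hr0 : 0 < r0) (σ2 : NNReal) (z : Space3 → Ω → ℂ)
    (hz : IsSpatiallyWhite P r0 σ2 z) (Y : ℝ → ℝ → ℂ) (M : ℝ)
    (hY : ∀ φ, ∀ θ ∈ Set.Icc 0 Real.pi, ‖Y φ θ‖ ≤ M) :
    ∀ᵐ ω ∂P, Tendsto (sphereRiemannSum fun φ θ => z (sphPoint r0 φ θ) ω * Y φ θ) atTop (𝓝 0) := by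
  -- The row `b = 0` is dropped: its points all coincide with the north pole, so their noise samples
  -- are not independent, but their weight contains `sin 0 = 0`.
  set G : ℕ → Finset (ℕ × ℕ) := fun N => Finset.range N ×ˢ Finset.Ico 1 N
  set Z : ℕ → ℕ × ℕ → Ω → ℂ := fun N p =>
    z (sphPoint r0 (2 * Real.pi * p.1 / N) (Real.pi * p.2 / N)) with hZ
  set w : ℕ → ℕ × ℕ → ℂ := fun N p =>
    Y (2 * Real.pi * p.1 / N) (Real.pi * p.2 / N) *
      ((Real.sin (Real.pi * p.2 / N) * (2 * Real.pi / N) * (Real.pi / N) : ℝ) : ℂ) with hw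
  have hsum : ∀ ω N, sphereRiemannSum (fun φ θ => z (sphPoint r0 φ θ) ω * Y φ θ) N =
      ∑ p ∈ G N, Z N p ω * w N p := by
    intro ω N
    rw [sphereRiemannSum, Finset.sum_product]
    refine Finset.sum_congr rfl fun a _ => ?_
    rcases Nat.eq_zero_or_pos N with rfl | hN
    · simp
    · rw [← Nat.Ico_zero_eq_range, Finset.sum_eq_sum_Ico_succ_bot hN]
      simp only [hZ, hw, CharP.cast_eq_zero, mul_zero, zero_div, Real.sin_zero, zero_mul,
        Complex.ofReal_zero, zero_add]
      exact Finset.sum_congr rfl fun b _ => by ring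
  have hsph : ∀ N p, sphPoint r0 (2 * Real.pi * (p : ℕ × ℕ).1 / (N : ℕ)) (Real.pi * p.2 / N) ∈
      Metric.sphere (0 : Space3) r0 := fun N p => by
    rw [mem_sphere_zero_iff_norm, norm_sphPoint _ _ _ hr0.le]
  have hlaw : ∀ N, ∀ p ∈ G N, HasLaw (Z N p) (complexNormal σ2) P := fun N p _ =>
    hz.law _ (hsph N p)
  have hind : ∀ N, ∀ p ∈ G N, ∀ p' ∈ G N, p ≠ p' → IndepFun (Z N p) (Z N p') P := by
    intro N p hp p' hp' hne
    simp only [G, Finset.mem_product, Finset.mem_range, Finset.mem_Ico] at hp hp'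
    refine hz.indep _ (hsph N p) _ (hsph N p') fun h => hne ?_
    have := sphPoint_grid_injective r0 hr0 N p.1 p.2 p'.1 p'.2 hp.1 hp.2.2 hp'.1 hp'.2.2
      (by omega) h
    exact Prod.ext this.1 this.2
  have hM : 0 ≤ M := (norm_nonneg _).trans (hY 0 0 ⟨le_rfl, Real.pi_pos.le⟩)
  -- At most `N²` points, each with squared weight `O(N⁻⁴)`. For `N = 0` the grid is empty, which
  -- agrees with the convention `1 / 0 = 0`.
  have hwle : ∀ N, ∑ p ∈ G N, ‖w N p‖ ^ 2 ≤ (M * (2 * Real.pi ^ 2)) ^ 2 * (1 / (N : ℝ) ^ 2) := by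
    intro N
    rcases Nat.eq_zero_or_pos N with rfl | hN
    · simp [G]
    have hN' : (0 : ℝ) < N := by exact_mod_cast hN
    have hone : ∀ p ∈ G N, ‖w N p‖ ^ 2 ≤ (M * (2 * Real.pi ^ 2)) ^ 2 * (1 / (N : ℝ) ^ 4) := by
      intro p hp
      simp only [G, Finset.mem_product, Finset.mem_range, Finset.mem_Ico] at hp
      have hp2 : (p.2 : ℝ) ≤ N := by exact_mod_cast hp.2.2.le
      have hmem : Real.pi * p.2 / N ∈ Set.Icc 0 Real.pi := by
        have := Real.pi_pos
        refine ⟨by positivity, ?_⟩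
        rw [div_le_iff₀ hN']; gcongr
      have : ‖w N p‖ ≤ M * (1 * (2 * Real.pi / N) * (Real.pi / N)) := by
        have := Real.pi_pos
        rw [hw, norm_mul, Complex.norm_real, norm_mul, norm_mul,
          Real.norm_of_nonneg (by positivity : 0 ≤ 2 * Real.pi / N),
          Real.norm_of_nonneg (by positivity : 0 ≤ Real.pi / N)]
        gcongr
        · exact hY _ _ hmem
        · exact Real.abs_sin_le_one _
      calc ‖w N p‖ ^ 2 ≤ (M * (1 * (2 * Real.pi / N) * (Real.pi / N))) ^ 2 := by gcongr
        _ = _ := by field_simp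
    refine (Finset.sum_le_card_nsmul _ _ _ hone).trans ?_
    have hcard : ((G N).card : ℝ) ≤ (N : ℝ) ^ 2 := by
      have : (G N).card ≤ N ^ 2 := by
        simp only [G, Finset.card_product, Finset.card_range, Nat.card_Ico, sq]
        gcongr; omega
      exact_mod_cast this
    rw [nsmul_eq_mul]
    calc _ ≤ (N : ℝ) ^ 2 * ((M * (2 * Real.pi ^ 2)) ^ 2 * (1 / (N : ℝ) ^ 4)) := by gcongr
      _ = _ := by field_simp
  have hmeas : ∀ N, AEMeasurable (fun ω => ∑ p ∈ G N, Z N p ω * w N p) P := fun N =>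
    Finset.aemeasurable_fun_sum _ fun p hp => (hlaw N p hp).aemeasurable.mul_const _
  have hV : 0 ≤ ∫ v, ‖v‖ ^ 2 ∂(complexNormal σ2) := integral_nonneg fun v => by positivity
  have hpart : ∀ L : ℂ →L[ℝ] ℝ, (∀ v, |L v| ≤ ‖v‖) →
      ∀ᵐ ω ∂P, Tendsto (fun N => L (∑ p ∈ G N, Z N p ω * w N p)) atTop (𝓝 0) := by
    intro L hL
    refine ae_tendsto_zero_of_lintegral_sq_le P _
      (fun N => L.continuous.measurable.comp_aemeasurable (hmeas N))
      ((∫ v, ‖v‖ ^ 2 ∂(complexNormal σ2)) * (M * (2 * Real.pi ^ 2)) ^ 2)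
      fun N => ?_
    refine (lintegral_sq_sum_le P _ (memLp_id_complexNormal σ2) (integral_id_complexNormal σ2)
      L hL (G N) (Z N) (w N) (hlaw N) (hind N)).trans (ENNReal.ofReal_le_ofReal ?_)
    rw [mul_assoc]
    gcongr
    exact hwle N
  filter_upwards [hpart Complex.reCLM Complex.abs_re_le_norm,
    hpart Complex.imCLM Complex.abs_im_le_norm] with ω hre him
  have h := ((Complex.continuous_ofReal.tendsto 0).comp hre).add
    (((Complex.continuous_ofReal.tendsto 0).comp him).mul_const Complex.I)
  simp only [Complex.ofReal_zero, zero_mul, add_zero] at h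
  refine h.congr fun N => ?_
  rw [hsum]
  exact Complex.re_add_im _

/-! ### The apolar pairing of binary forms -/

/-- The apolar pairing of two binary forms of degree `N`, in dehomogenized coordinates. -/
noncomputable def apolarPairing (N : ℕ) (p r : Polynomial ℂ) : ℂ :=
  ∑ n ∈ Finset.range (N + 1), (n.factorial : ℂ) * ((N - n).factorial : ℂ) * p.coeff n * r.coeff n

theorem apolarPairing_comm (N : ℕ) (p r : Polynomial ℂ) :
    apolarPairing N p r = apolarPairing N r p :=
  Finset.sum_congr rfl fun n _ => by ring

theorem apolarPairing_add_left (N : ℕ) (p p' r : Polynomial ℂ) :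
    apolarPairing N (p + p') r = apolarPairing N p r + apolarPairing N p' r := by
  simp only [apolarPairing, ← Finset.sum_add_distrib, Polynomial.coeff_add]
  exact Finset.sum_congr rfl fun n _ => by ring

theorem apolarPairing_C_mul_left (N : ℕ) (a : ℂ) (p r : Polynomial ℂ) :
    apolarPairing N (Polynomial.C a * p) r = a * apolarPairing N p r := by
  simp only [apolarPairing, Finset.mul_sum, Polynomial.coeff_C_mul]
  exact Finset.sum_congr rfl fun n _ => by ring

theorem apolarPairing_add_right (N : ℕ) (p r r' : Polynomial ℂ) :
    apolarPairing N p (r + r') = apolarPairing N p r + apolarPairing N p r' := by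
  simp only [apolarPairing_comm N p, apolarPairing_add_left]

theorem apolarPairing_C_mul_right (N : ℕ) (a : ℂ) (p r : Polynomial ℂ) :
    apolarPairing N p (Polynomial.C a * r) = a * apolarPairing N p r := by
  simp only [apolarPairing_comm N p, apolarPairing_C_mul_left]

/-- The factorial weights make multiplication by a variable adjoint to differentiation in it. -/
theorem apolarPairing_X_mul (N : ℕ) (p r : Polynomial ℂ) :
    apolarPairing (N + 1) (Polynomial.X * p) r = apolarPairing N p (Polynomial.derivative r) := by
  unfold apolarPairing
  rw [Finset.sum_range_succ']
  simp only [Polynomial.coeff_X_mul, Polynomial.coeff_derivative, Polynomial.mul_coeff_zero,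
    Polynomial.coeff_X_zero, zero_mul, mul_zero, add_zero]
  refine Finset.sum_congr rfl fun n _ => ?_
  rw [Nat.factorial_succ, Nat.add_sub_add_right]
  push_cast
  ring

/-- The same adjointness for the homogenizing variable: raising the formal degree of `p` multiplies
the form by that variable, and by Euler's identity the derivative of `r` in it is `(N + 1) r - X
r'`. The degree bound removes the top coefficient. -/
theorem apolarPairing_succ (N : ℕ) (p r : Polynomial ℂ) (hp : p.natDegree ≤ N) :
    apolarPairing (N + 1) p r = apolarPairing N p
      (Polynomial.C ((N : ℂ) + 1) * r - Polynomial.X * Polynomial.derivative r) := by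
  unfold apolarPairing
  rw [Finset.sum_range_succ, Polynomial.coeff_eq_zero_of_natDegree_lt (by omega : p.natDegree < N + 1)]
  simp only [mul_zero, zero_mul, add_zero]
  refine Finset.sum_congr rfl fun n hn => ?_
  have hn' : n ≤ N := by simpa [Nat.lt_succ_iff] using hn
  have h1 : (Polynomial.X * Polynomial.derivative r).coeff n = n * r.coeff n := by
    cases n with
    | zero => simp
    | succ k => rw [Polynomial.coeff_X_mul, Polynomial.coeff_derivative]; push_cast; ring
  rw [Polynomial.coeff_sub, Polynomial.coeff_C_mul, h1, Nat.succ_sub hn', Nat.factorial_succ]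
  push_cast [Nat.cast_sub hn']
  ring

/-- The quadratic polynomial `a + b X + c X²`. -/
noncomputable def quadPoly {R : Type*} [CommRing R] (a b c : R) : Polynomial R :=
  Polynomial.C a + Polynomial.C b * Polynomial.X + Polynomial.C c * Polynomial.X ^ 2

theorem natDegree_quadPoly_pow_le {R : Type*} [CommRing R] (a b c : R) (k : ℕ) :
    (quadPoly a b c ^ k).natDegree ≤ 2 * k := by
  have h : (quadPoly a b c).natDegree ≤ 2 := by
    unfold quadPoly
    compute_degree
  exact (Polynomial.natDegree_pow_le_of_le k h).trans (by omega)

/-- The differential operator on forms of degree `N + 2` that is adjoint, for the apolar pairing,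
to the multiplication by a quadratic form. -/
noncomputable def quadDiff (N : ℕ) (a b c : ℂ) (r : Polynomial ℂ) : Polynomial ℂ :=
  Polynomial.C c * Polynomial.derivative (Polynomial.derivative r) +
    (Polynomial.C b * (Polynomial.C ((N : ℂ) + 1) * Polynomial.derivative r -
      Polynomial.X * Polynomial.derivative (Polynomial.derivative r)) +
    Polynomial.C a * (Polynomial.C ((N : ℂ) + 1) *
      (Polynomial.C ((N : ℂ) + 2) * r - Polynomial.X * Polynomial.derivative r) -
      Polynomial.X * Polynomial.derivative
        (Polynomial.C ((N : ℂ) + 2) * r - Polynomial.X * Polynomial.derivative r)))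

theorem apolarPairing_quadPoly_mul (N : ℕ) (a b c : ℂ) (p r : Polynomial ℂ)
    (hp : p.natDegree ≤ N) :
    apolarPairing (N + 2) (quadPoly a b c * p) r = apolarPairing N p (quadDiff N a b c r) := by
  have h : quadPoly a b c * p = Polynomial.C c * (Polynomial.X * (Polynomial.X * p)) +
      (Polynomial.C b * (Polynomial.X * p) + Polynomial.C a * p) := by
    unfold quadPoly; ring
  have h2 : ((N + 1 : ℕ) : ℂ) + 1 = (N : ℂ) + 2 := by push_cast; ring
  simp only [h, quadDiff, apolarPairing_add_left, apolarPairing_C_mul_left,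
    apolarPairing_add_right, apolarPairing_C_mul_right]
  rw [apolarPairing_X_mul, apolarPairing_X_mul, apolarPairing_X_mul,
    apolarPairing_succ N p _ hp, apolarPairing_succ (N + 1) p _ (by omega),
    apolarPairing_succ N p _ hp, h2]

/-- A second-order operator applied to a power `R ^ (k + 2)` yields a multiple of `R ^ (k + 1)` and
`R ^ k` times a quadratic expression in the derivatives of `R`. The normalized discriminant of `R`
and the polar invariant `τ` express the latter through `R` and the form defining the operator. For
forms coming from unit vectors, `τ` is the cosine of their angle. -/
theorem quadDiff_quadPoly_pow (k : ℕ) (a b a' b' c' τ : ℂ) (h' : b' ^ 2 - 4 * a' * c' = 4)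
    (hτ : 2 * a * a' + b * b' - 2 * a * c' = 4 * τ) :
    quadDiff (2 * k + 2) a b (-a) (quadPoly a' b' c' ^ (k + 2)) =
      Polynomial.C (4 * ((k : ℂ) + 2) * (2 * k + 3) * τ) * quadPoly a' b' c' ^ (k + 1) +
      Polynomial.C (-4 * ((k : ℂ) + 2) * (k + 1)) *
        (quadPoly a b (-a) * quadPoly a' b' c' ^ k) := by
  have hd : Polynomial.derivative (quadPoly a' b' c') =
      Polynomial.C b' + Polynomial.C c' * (2 * Polynomial.X) := by
    simp only [quadPoly, map_add, Polynomial.derivative_C, Polynomial.derivative_C_mul,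
      Polynomial.derivative_X, Polynomial.derivative_X_sq, zero_add, mul_one, map_ofNat]
  have hd2 : Polynomial.derivative (Polynomial.C b' + Polynomial.C c' * (2 * Polynomial.X)) =
      Polynomial.C c' * 2 := by
    simp
  have e1 := congrArg (Polynomial.C : ℂ → Polynomial ℂ) h'
  have e2 := congrArg (Polynomial.C : ℂ → Polynomial ℂ) hτ
  simp only [map_add, map_sub, map_mul, map_pow, map_ofNat] at e1 e2
  have hR : quadPoly a' b' c' = Polynomial.C a' + Polynomial.C b' * Polynomial.X +
    Polynomial.C c' * Polynomial.X ^ 2 := rfl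
  have hQ : quadPoly a b (-a) = Polynomial.C a + Polynomial.C b * Polynomial.X -
    Polynomial.C a * Polynomial.X ^ 2 := by simp [quadPoly]; ring
  simp only [quadDiff, Polynomial.derivative_pow, Polynomial.derivative_mul,
    Polynomial.derivative_sub, Polynomial.derivative_ofNat, hd, hd2, Polynomial.derivative_X,
    Polynomial.derivative_natCast, Nat.cast_add, Nat.cast_mul, Nat.cast_ofNat, Nat.cast_one,
    map_add, map_mul, map_neg, map_one, map_ofNat, map_natCast, Nat.add_sub_cancel,
    show k + 2 - 1 = k + 1 by omega]
  generalize quadPoly a' b' c' = R at *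
  generalize quadPoly a b (-a) = Q at *
  have hk : R ^ (k + 2) = R ^ k * R ^ 2 := pow_add _ _ _
  have hk1 : R ^ (k + 1) = R ^ k * R := pow_succ _ _
  rw [hk, hk1]
  generalize R ^ k = S
  subst hR hQ
  linear_combination (exp := 1) e2 * ((k + 2 : Polynomial ℂ) * S * (Polynomial.C a' +
    Polynomial.C b' * Polynomial.X + Polynomial.C c' * Polynomial.X ^ 2) * (2 * k + 3)) -
    e1 * ((k + 2 : Polynomial ℂ) * (k + 1) * S * (Polynomial.C a + Polynomial.C b * Polynomial.X -
    Polynomial.C a * Polynomial.X ^ 2))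

/-- The case of equal forms and `τ = 1`, where the two terms merge. The first power is computed by
hand because the general formula starts at the square. -/
theorem quadDiff_quadPoly_pow_self (k : ℕ) (a b : ℂ) (h : b ^ 2 + 4 * a ^ 2 = 4) :
    quadDiff (2 * k) a b (-a) (quadPoly a b (-a) ^ (k + 1)) =
      Polynomial.C (4 * ((k : ℂ) + 1) ^ 2) * quadPoly a b (-a) ^ k := by
  cases k with
  | zero =>
    have e1 := congrArg (Polynomial.C : ℂ → Polynomial ℂ) h
    simp only [map_add, map_mul, map_pow, map_ofNat] at e1
    simp [quadDiff, quadPoly]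
    simp only [map_ofNat]
    linear_combination e1
  | succ j =>
    have := quadDiff_quadPoly_pow j a b a b (-a) 1 (by linear_combination h)
      (by linear_combination h)
    rw [show 2 * (j + 1) = 2 * j + 2 by ring, this]
    simp only [map_add, map_mul, map_neg, map_one, map_ofNat, map_natCast, map_pow, Nat.cast_add,
      Nat.cast_one]
    ring

/-- The apolar pairing of the `ℓ`-th powers of two quadratic forms. -/
noncomputable def apolarPow (a b a' b' c' : ℂ) (ℓ : ℕ) : ℂ :=
  apolarPairing (2 * ℓ) (quadPoly a b (-a) ^ ℓ) (quadPoly a' b' c' ^ ℓ)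

/-- One factor of the left power is moved across as a differential operator. This produces a
multiple of the preceding pairing and a pairing with an extra factor of the first form on the right;
moving that factor back differentiates the left power and leaves the pairing of index `k`. -/
theorem apolarPow_add_two (a b a' b' c' τ : ℂ) (h : b ^ 2 + 4 * a ^ 2 = 4)
    (h' : b' ^ 2 - 4 * a' * c' = 4)
    (hτ : 2 * a * a' + b * b' - 2 * a * c' = 4 * τ) (k : ℕ) :
    apolarPow a b a' b' c' (k + 2) =
      4 * ((k : ℂ) + 2) * (2 * k + 3) * τ * apolarPow a b a' b' c' (k + 1) -
        16 * ((k : ℂ) + 2) * (k + 1) ^ 3 * apolarPow a b a' b' c' k := by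
  unfold apolarPow
  rw [show quadPoly a b (-a) ^ (k + 2) = quadPoly a b (-a) * quadPoly a b (-a) ^ (k + 1) by ring,
    show 2 * (k + 2) = 2 * (k + 1) + 2 by ring,
    apolarPairing_quadPoly_mul _ _ _ _ _ _ (natDegree_quadPoly_pow_le _ _ _ _),
    show 2 * (k + 1) = 2 * k + 2 by ring, quadDiff_quadPoly_pow k a b a' b' c' τ h' hτ,
    apolarPairing_add_right, apolarPairing_C_mul_right, apolarPairing_C_mul_right,
    apolarPairing_comm _ _ (quadPoly a b (-a) * _),
    apolarPairing_quadPoly_mul _ _ _ _ _ _ (natDegree_quadPoly_pow_le _ _ _ _),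
    quadDiff_quadPoly_pow_self k a b h, apolarPairing_C_mul_right,
    apolarPairing_comm (2 * k) (quadPoly a' b' c' ^ k)]
  ring

theorem apolarPow_zero (a b a' b' c' : ℂ) : apolarPow a b a' b' c' 0 = 1 := by
  simp [apolarPow, apolarPairing]

theorem apolarPow_one (a b a' b' c' : ℂ) :
    apolarPow a b a' b' c' 1 = 2 * a * a' + b * b' - 2 * a * c' := by
  simp [apolarPow, apolarPairing, Finset.sum_range_succ, quadPoly, Polynomial.coeff_X,
    Polynomial.coeff_C]
  ring

/-! ### Spherical harmonics as coefficients of a power -/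

/-- The coefficient of `Xⁿ` in `(-s + 2 x X + s X²) ^ ℓ`. -/
noncomputable def harmCoeff (ℓ n : ℕ) (x s : ℝ) : ℝ :=
  (quadPoly (-s) (2 * x) s ^ ℓ).coeff n

/-- With `x = cos θ` and `s = sin θ`, `(x + s X)² - 1 = s (-s + 2 x X + s X²)`. Splitting off `s ^
ℓ` absorbs the half-integer power of `1 - x²` in the Legendre functions, leaving polynomials in `x`
and `s`. -/
theorem taylor_sq_sub_one_pow (ℓ : ℕ) (x s : ℝ) (h : x ^ 2 + s ^ 2 = 1) :
    (Polynomial.taylor x ((Polynomial.X ^ 2 - 1 : Polynomial ℝ) ^ ℓ)).comp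
      (Polynomial.C s * Polynomial.X) = Polynomial.C (s ^ ℓ) * quadPoly (-s) (2 * x) s ^ ℓ := by
  have e1 := congrArg (Polynomial.C : ℝ → Polynomial ℝ) h
  simp only [map_add, map_pow, map_one] at e1
  have hb : ((Polynomial.X + Polynomial.C x) ^ 2 - 1 : Polynomial ℝ).comp
      (Polynomial.C s * Polynomial.X) = Polynomial.C s * quadPoly (-s) (2 * x) s := by
    simp only [Polynomial.pow_comp, Polynomial.sub_comp, Polynomial.X_comp,
      Polynomial.one_comp, Polynomial.add_comp, Polynomial.C_comp, quadPoly, map_neg, map_mul,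
      map_ofNat]
    linear_combination e1
  rw [Polynomial.C_pow, ← mul_pow, ← hb]
  simp only [Polynomial.taylor_apply, Polynomial.pow_comp, Polynomial.sub_comp, Polynomial.X_comp,
    Polynomial.one_comp]

theorem eval_iterate_derivative_sq_sub_one (ℓ n : ℕ) (x : ℝ) :
    (Polynomial.derivative^[n] ((Polynomial.X ^ 2 - 1 : Polynomial ℝ) ^ ℓ)).eval x =
      (n.factorial : ℝ) * (Polynomial.taylor x ((Polynomial.X ^ 2 - 1 : Polynomial ℝ) ^ ℓ)).coeff n := by
  rw [Polynomial.taylor_coeff, ← Polynomial.factorial_smul_hasseDeriv]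
  simp

theorem assocLegendre_eq_harmCoeff (ℓ n : ℕ) (x s : ℝ) (hs : 0 ≤ s) (h : x ^ 2 + s ^ 2 = 1) :
    assocLegendre ℓ ((n : ℤ) - ℓ) x =
      (-1) ^ ((n : ℤ) - ℓ) * (n.factorial : ℝ) / (2 ^ ℓ * (ℓ.factorial : ℝ)) *
        harmCoeff ℓ n x s := by
  have hn : ((ℓ : ℤ) + ((n : ℤ) - ℓ)).toNat = n := by omega
  have key := congrArg (fun p => Polynomial.coeff p n) (taylor_sq_sub_one_pow ℓ x s h)
  simp only [Polynomial.comp_C_mul_X_coeff, Polynomial.coeff_C_mul] at key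
  have hx : 1 - x ^ 2 = s ^ 2 := by linarith
  rw [assocLegendre, hn, eval_iterate_derivative_sq_sub_one, hx]
  suffices hh : (s ^ 2) ^ ((((n : ℤ) - ℓ : ℤ) : ℝ) / 2) *
      (Polynomial.taylor x ((Polynomial.X ^ 2 - 1 : Polynomial ℝ) ^ ℓ)).coeff n =
        harmCoeff ℓ n x s by
    rw [← hh]; ring
  -- At the poles `s = 0` the quadratic reduces to `2 x X`, so only `n = ℓ` contributes. On the
  -- other side `0 ^ (m / 2) = 0` for every `m ≠ 0`, negative orders included.
  rcases hs.eq_or_lt with hs0 | hs0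
  · subst hs0
    have hq : harmCoeff ℓ n x 0 = if n = ℓ then (2 * x) ^ ℓ else 0 := by
      have : quadPoly (-0) (2 * x) 0 ^ ℓ = Polynomial.C ((2 * x) ^ ℓ) * Polynomial.X ^ ℓ := by
        simp [quadPoly, mul_pow]
      rw [harmCoeff, this, Polynomial.coeff_C_mul, Polynomial.coeff_X_pow]
      simp
    rw [hq]
    split_ifs with hnl
    · subst hnl
      have e1 := congrArg (Polynomial.C : ℝ → Polynomial ℝ) h
      simp only [map_add, map_pow, map_one] at e1
      have : Polynomial.taylor x ((Polynomial.X ^ 2 - 1 : Polynomial ℝ) ^ n) =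
          (Polynomial.X + Polynomial.C (2 * x)) ^ n * Polynomial.X ^ n := by
        rw [Polynomial.taylor_apply, ← mul_pow, Polynomial.pow_comp]
        congr 1
        simp only [Polynomial.sub_comp, Polynomial.pow_comp, Polynomial.X_comp,
          Polynomial.one_comp, map_mul, map_ofNat]
        rw [map_zero] at e1
        linear_combination e1
      rw [this, Polynomial.coeff_mul_X_pow', if_pos le_rfl, Nat.sub_self,
        Polynomial.coeff_zero_eq_eval_zero]
      simp
    · rw [zero_pow two_ne_zero, Real.zero_rpow, zero_mul]
      have : ((n : ℤ) - ℓ) ≠ 0 := by omega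
      have : (((n : ℤ) - ℓ : ℤ) : ℝ) ≠ 0 := by exact_mod_cast this
      positivity
  · rw [show (s ^ 2 : ℝ) = s ^ (2 : ℝ) by norm_cast, ← Real.rpow_mul hs,
      mul_div_cancel₀ _ (two_ne_zero), Real.rpow_intCast, zpow_sub₀ hs0.ne', zpow_natCast,
      zpow_natCast, div_mul_eq_mul_div, div_eq_iff (by positivity), mul_comm, key, harmCoeff]
    ring

theorem continuous_harmCoeff (ℓ n : ℕ) : Continuous (Function.uncurry (harmCoeff ℓ n)) := by
  induction ℓ generalizing n with
  | zero =>
    have h : Function.uncurry (harmCoeff 0 n) = fun _ => (1 : Polynomial ℝ).coeff n := by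
      funext p; simp only [Function.uncurry, harmCoeff, pow_zero]
    rw [h]
    exact continuous_const
  | succ k ih =>
    have h : ∀ p : ℝ × ℝ, Function.uncurry (harmCoeff (k + 1) n) p =
        ∑ ij ∈ Finset.HasAntidiagonal.antidiagonal n, harmCoeff k ij.1 p.1 p.2 *
          (quadPoly (-p.2) (2 * p.1) p.2).coeff ij.2 := fun p => by
      simp only [Function.uncurry, harmCoeff, pow_succ, Polynomial.coeff_mul]
    rw [funext h]
    refine continuous_finsetSum _ fun ij _ => (ih ij.1).mul ?_
    simp only [quadPoly, Polynomial.coeff_add, Polynomial.coeff_C_mul, Polynomial.coeff_X_pow,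
      Polynomial.coeff_C, Polynomial.coeff_X]
    split_ifs <;> fun_prop

/-- The spherical harmonic of degree `ℓ` and order `n - ℓ`, as a smooth function of the angles. -/
noncomputable def sphHarmPoly (ℓ n : ℕ) (φ θ : ℝ) : ℂ :=
  ((√((2 * (ℓ : ℝ) + 1) / (4 * Real.pi) *
      (((2 * ℓ - n).factorial : ℝ) / (n.factorial : ℝ))) *
    ((-1) ^ ((n : ℤ) - ℓ) * (n.factorial : ℝ) / (2 ^ ℓ * (ℓ.factorial : ℝ)) *
        harmCoeff ℓ n (Real.cos θ) (Real.sin θ)) : ℝ) : ℂ) *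
    Complex.exp (Complex.I * (((n : ℤ) - ℓ : ℤ) : ℂ) * (φ : ℂ))

theorem sphHarm_eq_sphHarmPoly (ℓ n : ℕ) (φ θ : ℝ) (hθ : θ ∈ Set.Icc 0 Real.pi) :
    sphHarm ℓ ((n : ℤ) - ℓ) φ θ = sphHarmPoly ℓ n φ θ := by
  rw [sphHarm, sphHarmPoly, assocLegendre_eq_harmCoeff ℓ n _ (Real.sin θ)
    (Real.sin_nonneg_of_mem_Icc hθ) (Real.cos_sq_add_sin_sq θ)]
  rw [show ((ℓ : ℤ) - ((n : ℤ) - ℓ)).toNat = 2 * ℓ - n by omega,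
    show ((ℓ : ℤ) + ((n : ℤ) - ℓ)).toNat = n by omega]

theorem continuous_sphHarmPoly (ℓ n : ℕ) : Continuous (Function.uncurry (sphHarmPoly ℓ n)) := by
  have h : Continuous fun p : ℝ × ℝ => harmCoeff ℓ n (Real.cos p.2) (Real.sin p.2) :=
    (continuous_harmCoeff ℓ n).comp (f := fun p : ℝ × ℝ => (Real.cos p.2, Real.sin p.2))
      (by fun_prop)
  unfold sphHarmPoly Function.uncurry
  fun_prop

theorem sum_Icc_neg_eq_sum_range {M : Type*} [AddCommMonoid M] (ℓ : ℕ) (f : ℤ → M) :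
    ∑ m ∈ Finset.Icc (-(ℓ : ℤ)) ℓ, f m = ∑ n ∈ Finset.range (2 * ℓ + 1), f ((n : ℤ) - ℓ) := by
  refine (Finset.sum_nbij' (fun n : ℕ => (n : ℤ) - ℓ) (fun m => (m + ℓ).toNat) ?_ ?_ ?_ ?_ ?_).symm
  · intro n hn; simp only [Finset.mem_range, Finset.mem_Icc] at *; omega
  · intro n hn; simp only [Finset.mem_range, Finset.mem_Icc] at *; omega
  · intro n hn; simp only [Finset.mem_range] at *; omega
  · intro n hn; simp only [Finset.mem_Icc] at *; omega
  · intro n _; rfl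

/-! ### The zonal kernel -/

/-- The cosine of the angle between the directions with angles `(φ', θ')` and `(φ, θ)`. -/
noncomputable def cosAngle (φ' θ' φ θ : ℝ) : ℝ :=
  Real.cos θ' * Real.cos θ + Real.sin θ' * Real.sin θ * Real.cos (φ - φ')

/-- The reproducing kernel of the spherical harmonics of degree `ℓ`, normalized to be `1` on the
diagonal. -/
noncomputable def zonalKernel (ℓ : ℕ) (φ' θ' φ θ : ℝ) : ℂ :=
  4 * Real.pi / (2 * ℓ + 1) *
    ∑ n ∈ Finset.range (2 * ℓ + 1), star (sphHarmPoly ℓ n φ' θ') * sphHarmPoly ℓ n φ θ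

/-- A rotation in azimuth acts by the substitution `X ↦ e X`, up to a scalar; this supplies the
factors `exp(i m φ)`. -/
theorem coeff_quadPoly_pow_rotate (ℓ n : ℕ) (x s : ℝ) (e f : ℂ) (hef : e * f = 1) :
    (quadPoly (-s * f) (2 * x) (s * e : ℂ) ^ ℓ).coeff n = f ^ ℓ * e ^ n * harmCoeff ℓ n x s := by
  have h : quadPoly (-s * f) (2 * x) (s * e : ℂ) = Polynomial.C f *
      ((quadPoly (-s) (2 * x) s : Polynomial ℝ).map (algebraMap ℝ ℂ)).comp
        (Polynomial.C e * Polynomial.X) := by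
    have e1 := congrArg (Polynomial.C : ℂ → Polynomial ℂ) hef
    simp only [map_mul, map_one] at e1
    simp only [quadPoly, Polynomial.map_add, Polynomial.map_mul, Polynomial.map_C,
      Polynomial.map_X, Polynomial.map_pow, Polynomial.map_neg, Polynomial.neg_comp,
      Polynomial.add_comp, Polynomial.mul_comp,
      Polynomial.C_comp, Polynomial.X_comp, Polynomial.pow_comp, Complex.coe_algebraMap,
      Complex.ofReal_ofNat, map_neg, map_mul]
    linear_combination -e1 * (Polynomial.C 2 * Polynomial.C (x : ℂ) * Polynomial.X +
      Polynomial.C (s : ℂ) * Polynomial.C e * Polynomial.X ^ 2)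
  rw [h, mul_pow, ← Polynomial.C_pow, Polynomial.coeff_C_mul, ← Polynomial.pow_comp,
    ← Polynomial.map_pow, Polynomial.comp_C_mul_X_coeff, Polynomial.coeff_map, harmCoeff,
    Complex.coe_algebraMap]
  ring

/-- The squared normalization `(2ℓ - n)! / n!` times the `n!²` from the two derivatives is `n! (2ℓ -
n)!`, exactly the apolar weight in degree `2ℓ`. -/
theorem zonalKernel_eq_apolarPow (ℓ : ℕ) (φ' θ' φ θ : ℝ) :
    zonalKernel ℓ φ' θ' φ θ = apolarPow (-Real.sin θ') (2 * Real.cos θ')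
      (-Real.sin θ * Complex.exp (-(Complex.I * (φ - φ')))) (2 * Real.cos θ)
      (Real.sin θ * Complex.exp (Complex.I * (φ - φ'))) ℓ / (4 ^ ℓ * (ℓ.factorial : ℂ) ^ 2) := by
  have hpi : (Real.pi : ℂ) ≠ 0 := by exact_mod_cast Real.pi_ne_zero
  have hl : (2 * (ℓ : ℂ) + 1) ≠ 0 := by exact_mod_cast (by omega : 2 * ℓ + 1 ≠ 0)
  have hlf : (ℓ.factorial : ℂ) ≠ 0 := by exact_mod_cast ℓ.factorial_ne_zero
  rw [zonalKernel, apolarPow, apolarPairing, Finset.mul_sum, Finset.sum_div]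
  refine Finset.sum_congr rfl fun n hn => ?_
  have hn' : n ≤ 2 * ℓ := by simpa [Nat.lt_succ_iff] using hn
  have h1 : (quadPoly (-Real.sin θ' : ℂ) (2 * Real.cos θ') (-(-Real.sin θ')) ^ ℓ).coeff n =
      harmCoeff ℓ n (Real.cos θ') (Real.sin θ') := by
    have := coeff_quadPoly_pow_rotate ℓ n (Real.cos θ') (Real.sin θ') 1 1 (one_mul 1)
    simpa using this
  rw [h1, coeff_quadPoly_pow_rotate _ _ _ _ _ _ (by rw [← Complex.exp_add]; simp)]
  have hsq : ((√((2 * (ℓ : ℝ) + 1) / (4 * Real.pi) *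
      (((2 * ℓ - n).factorial : ℝ) / (n.factorial : ℝ))) : ℝ) : ℂ) ^ 2 =
      (2 * (ℓ : ℂ) + 1) / (4 * Real.pi) *
      (((2 * ℓ - n).factorial : ℂ) / (n.factorial : ℂ)) := by
    rw [← Complex.ofReal_pow, Real.sq_sqrt (by positivity)]
    push_cast; rfl
  have hsgn : ((-1 : ℂ) ^ ((n : ℤ) - ℓ)) ^ 2 = 1 := by
    rw [← zpow_natCast, zpow_comm]; simp
  have hexp : Complex.exp (-(Complex.I * (φ - φ'))) ^ ℓ * Complex.exp (Complex.I * (φ - φ')) ^ n =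
      star (Complex.exp (Complex.I * (((n : ℤ) - ℓ : ℤ) : ℂ) * (φ' : ℂ))) *
        Complex.exp (Complex.I * (((n : ℤ) - ℓ : ℤ) : ℂ) * (φ : ℂ)) := by
    rw [← Complex.exp_nat_mul, ← Complex.exp_nat_mul, ← Complex.exp_add, Complex.star_def,
      ← Complex.exp_conj, ← Complex.exp_add]
    congr 1
    simp only [map_mul, Complex.conj_I, Complex.conj_ofReal, map_intCast]
    push_cast
    ring
  have hnf : (n.factorial : ℂ) ≠ 0 := by exact_mod_cast n.factorial_ne_zero
  rw [mul_comm ((n.factorial : ℂ)) ((2 * ℓ - n).factorial : ℂ), hexp]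
  simp only [sphHarmPoly, star_mul', Complex.star_def, Complex.conj_ofReal]
  generalize (starRingEnd ℂ) (Complex.exp (Complex.I * (((n : ℤ) - ℓ : ℤ) : ℂ) * (φ' : ℂ))) = E'
  generalize Complex.exp (Complex.I * (((n : ℤ) - ℓ : ℤ) : ℂ) * (φ : ℂ)) = E
  push_cast
  generalize (-1 : ℂ) ^ ((n : ℤ) - ℓ) = u at *
  generalize ((√((2 * (ℓ : ℝ) + 1) / (4 * Real.pi) *
      (((2 * ℓ - n).factorial : ℝ) / (n.factorial : ℝ))) : ℝ) : ℂ) = v at *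
  calc _ = 4 * (Real.pi : ℂ) / (2 * ℓ + 1) * v ^ 2 * u ^ 2 * (n.factorial : ℂ) ^ 2 /
        (2 ^ ℓ * (ℓ.factorial : ℂ)) ^ 2 * (harmCoeff ℓ n (Real.cos θ') (Real.sin θ') *
          harmCoeff ℓ n (Real.cos θ) (Real.sin θ)) * (E' * E) := by ring
    _ = _ := by
      rw [hsq, hsgn, show (4 : ℂ) ^ ℓ = (2 ^ ℓ) ^ 2 by rw [← pow_mul, mul_comm, pow_mul]; norm_num]
      field_simp

theorem zonalKernel_zero (φ' θ' φ θ : ℝ) : zonalKernel 0 φ' θ' φ θ = 1 := by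
  rw [zonalKernel_eq_apolarPow, apolarPow_zero]; simp

theorem exp_add_exp_neg_angle (φ' φ : ℝ) :
    Complex.exp (Complex.I * (φ - φ')) + Complex.exp (-(Complex.I * (φ - φ'))) =
      2 * Real.cos (φ - φ') := by
  rw [Complex.ofReal_cos, Complex.two_cos]
  push_cast
  congr 2 <;> ring

theorem zonalKernel_one (φ' θ' φ θ : ℝ) :
    zonalKernel 1 φ' θ' φ θ = cosAngle φ' θ' φ θ := by
  have h := exp_add_exp_neg_angle φ' φ
  rw [zonalKernel_eq_apolarPow, apolarPow_one, cosAngle]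
  simp only [pow_one, Nat.factorial_one, Nat.cast_one, one_pow, mul_one]
  push_cast at h ⊢
  linear_combination (1 / 2 : ℂ) * Complex.sin θ' * Complex.sin θ * h

/-- The addition theorem in the form used here: with the values in degrees `0` and `1`, Legendre's
recurrence determines the kernel from `cosAngle`. -/
theorem zonalKernel_add_two (ℓ : ℕ) (φ' θ' φ θ : ℝ) :
    ((ℓ : ℂ) + 2) * zonalKernel (ℓ + 2) φ' θ' φ θ =
      (2 * ℓ + 3) * cosAngle φ' θ' φ θ * zonalKernel (ℓ + 1) φ' θ' φ θ -
        (ℓ + 1) * zonalKernel ℓ φ' θ' φ θ := by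
  have h := exp_add_exp_neg_angle φ' φ
  have hl2 : ((ℓ : ℂ) + 2) ≠ 0 := by exact_mod_cast (by omega : ℓ + 2 ≠ 0)
  have hl1 : ((ℓ : ℂ) + 1) ≠ 0 := by exact_mod_cast (by omega : ℓ + 1 ≠ 0)
  have hlf : (ℓ.factorial : ℂ) ≠ 0 := by exact_mod_cast ℓ.factorial_ne_zero
  have hs' : (Complex.cos θ') ^ 2 + Complex.sin θ' ^ 2 = 1 := Complex.cos_sq_add_sin_sq _
  have hs : (Complex.cos θ) ^ 2 + Complex.sin θ ^ 2 = 1 := Complex.cos_sq_add_sin_sq _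
  have he : Complex.exp (Complex.I * (φ - φ')) * Complex.exp (-(Complex.I * (φ - φ'))) = 1 := by
    rw [← Complex.exp_add]; simp
  simp only [zonalKernel_eq_apolarPow]
  rw [apolarPow_add_two _ _ _ _ _ (cosAngle φ' θ' φ θ)]
  · rw [Nat.factorial_succ (ℓ + 1), Nat.factorial_succ ℓ]
    push_cast
    have : ((ℓ : ℂ) + 1 + 1) ≠ 0 := by convert hl2 using 1; ring
    field_simp
    ring
  · push_cast; linear_combination 4 * hs'
  · push_cast; linear_combination 4 * hs + 4 * Complex.sin θ ^ 2 * he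
  · rw [cosAngle]
    push_cast at h ⊢
    linear_combination 2 * Complex.sin θ' * Complex.sin θ * h

theorem abs_cosAngle_le (φ' θ' φ θ : ℝ) : |cosAngle φ' θ' φ θ| ≤ 1 := by
  have h : |cosAngle φ' θ' φ θ| ^ 2 ≤ 1 ^ 2 := by
    rw [sq_abs, cosAngle]
    have h1 := Real.cos_sq_add_sin_sq θ'
    have h2 := Real.cos_sq_add_sin_sq θ
    have h3 := Real.cos_sq_add_sin_sq (φ - φ')
    -- The right side collects the squares of the two components of one unit vector orthogonal to
    -- the other.
    have key : 1 - (Real.cos θ' * Real.cos θ +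
        Real.sin θ' * Real.sin θ * Real.cos (φ - φ')) ^ 2 =
        (Real.cos θ' * Real.sin θ * Real.cos (φ - φ') - Real.sin θ' * Real.cos θ) ^ 2 +
        (Real.sin θ * Real.sin (φ - φ')) ^ 2 := by
      linear_combination -(Real.sin θ ^ 2 * Real.cos (φ - φ') ^ 2 + Real.cos θ ^ 2) * h1 - h2 -
        Real.sin θ ^ 2 * h3
    nlinarith [sq_nonneg (Real.cos θ' * Real.sin θ * Real.cos (φ - φ') - Real.sin θ' * Real.cos θ),
      sq_nonneg (Real.sin θ * Real.sin (φ - φ'))]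
  exact (sq_le_sq₀ (abs_nonneg _) zero_le_one).mp h

/-- A crude bound read off the recurrence; the `1 / ℓ!` decay of the Bessel factors absorbs it. -/
theorem norm_zonalKernel_le (ℓ : ℕ) (φ' θ' φ θ : ℝ) : ‖zonalKernel ℓ φ' θ' φ θ‖ ≤ 3 ^ ℓ := by
  have hc := abs_cosAngle_le φ' θ' φ θ
  induction ℓ using Nat.strong_induction_on with
  | _ ℓ ih =>
    match ℓ with
    | 0 => simp [zonalKernel_zero]
    | 1 => rw [zonalKernel_one, Complex.norm_real]; exact hc.trans (by norm_num)
    | k + 2 =>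
      have h1 := ih (k + 1) (by omega)
      have h0 := ih k (by omega)
      have hk : ((k : ℝ) + 2) * ‖zonalKernel (k + 2) φ' θ' φ θ‖ ≤
          (2 * k + 3) * 3 ^ (k + 1) + (k + 1) * 3 ^ k := by
        have e1 : ‖((k : ℂ) + 2)‖ = k + 2 := by
          rw [show ((k : ℂ) + 2) = ((k + 2 : ℝ) : ℂ) by push_cast; ring, Complex.norm_real,
            Real.norm_of_nonneg (by positivity)]
        have e2 : ‖(2 * (k : ℂ) + 3)‖ = 2 * k + 3 := by
          rw [show (2 * (k : ℂ) + 3) = ((2 * k + 3 : ℝ) : ℂ) by push_cast; ring, Complex.norm_real,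
            Real.norm_of_nonneg (by positivity)]
        have e3 : ‖((k : ℂ) + 1)‖ = k + 1 := by
          rw [show ((k : ℂ) + 1) = ((k + 1 : ℝ) : ℂ) by push_cast; ring, Complex.norm_real,
            Real.norm_of_nonneg (by positivity)]
        rw [← e1, ← norm_mul, zonalKernel_add_two]
        refine (norm_sub_le _ _).trans ?_
        rw [norm_mul, norm_mul, norm_mul, e2, e3, Complex.norm_real, Real.norm_eq_abs]
        gcongr
        calc (2 * (k : ℝ) + 3) * |cosAngle φ' θ' φ θ| ≤ (2 * k + 3) * 1 := by gcongr
          _ = _ := mul_one _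
      have : ((k : ℝ) + 2) * ‖zonalKernel (k + 2) φ' θ' φ θ‖ ≤ (k + 2) * 3 ^ (k + 2) := by
        refine hk.trans ?_
        have h3 : (0 : ℝ) < 3 ^ k := by positivity
        rw [show (3 : ℝ) ^ (k + 1) = 3 * 3 ^ k by ring, show (3 : ℝ) ^ (k + 2) = 9 * 3 ^ k by ring]
        nlinarith [mul_nonneg (Nat.cast_nonneg (α := ℝ) k) h3.le]
      exact le_of_mul_le_mul_left this (by positivity)

/-! ### Spherical Bessel functions and the plane wave expansion -/

open Classical in
/-- The coefficient of the Legendre polynomial `(2 ℓ + 1) P_ℓ` in `xⁿ / n!`. -/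
noncomputable def legendreExpCoeff (n ℓ : ℕ) : ℝ :=
  if ∃ i, n = ℓ + 2 * i then
    1 / (((n - ℓ).doubleFactorial : ℝ) * ((n + ℓ + 1).doubleFactorial : ℝ)) else 0

theorem legendreExpCoeff_add (ℓ i : ℕ) : legendreExpCoeff (ℓ + 2 * i) ℓ =
    1 / (((2 * i).doubleFactorial : ℝ) * ((2 * ℓ + 2 * i + 1).doubleFactorial : ℝ)) := by
  rw [legendreExpCoeff, if_pos ⟨i, rfl⟩, Nat.add_sub_cancel_left,
    show ℓ + 2 * i + ℓ + 1 = 2 * ℓ + 2 * i + 1 by ring]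

theorem legendreExpCoeff_eq_zero {n ℓ : ℕ} (h : ∀ i, n ≠ ℓ + 2 * i) : legendreExpCoeff n ℓ = 0 :=
  if_neg fun ⟨i, hi⟩ => h i hi

/-- Coefficient form of `(2ℓ+1) x P_ℓ = (ℓ+1) P_{ℓ+1} + ℓ P_{ℓ-1}`, passing from `xⁿ` to `xⁿ⁺¹`. At
`k = 0` the truncated `k - 1` is harmless, being multiplied by `k`. -/
theorem legendreExpCoeff_recurrence (n k : ℕ) :
    ((n : ℝ) + 1) * (2 * k + 1) * legendreExpCoeff (n + 1) k =
      k * legendreExpCoeff n (k - 1) + (k + 1) * legendreExpCoeff n (k + 1) := by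
  by_cases h : ∃ i, n + 1 = k + 2 * i
  · obtain ⟨i, hi⟩ := h
    have h1 : (k : ℝ) * legendreExpCoeff n (k - 1) = k * ((2 * k + 2 * i + 1) *
        legendreExpCoeff (n + 1) k) := by
      rcases k with _ | k
      · simp
      · rw [hi, show n = (k + 1 - 1) + 2 * i by omega, legendreExpCoeff_add,
          legendreExpCoeff_add, show 2 * (k + 1) + 2 * i + 1 = 2 * (k + 1 - 1) + 2 * i + 1 + 2 by omega,
          Nat.doubleFactorial_add_two]
        have := (2 * i).doubleFactorial_pos
        have := (2 * (k + 1 - 1) + 2 * i + 1).doubleFactorial_pos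
        push_cast [Nat.add_sub_cancel]
        field_simp
        ring
    have h2 : legendreExpCoeff n (k + 1) = 2 * i * legendreExpCoeff (n + 1) k := by
      rcases i with _ | i
      · rw [legendreExpCoeff_eq_zero (by omega)]; simp
      · rw [hi, show n = (k + 1) + 2 * i by omega, legendreExpCoeff_add, legendreExpCoeff_add,
          show 2 * (i + 1) = 2 * i + 2 by ring, Nat.doubleFactorial_add_two,
          show 2 * k + (2 * i + 2) + 1 = 2 * (k + 1) + 2 * i + 1 by ring]
        have := (2 * i).doubleFactorial_pos
        have := (2 * (k + 1) + 2 * i + 1).doubleFactorial_pos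
        push_cast
        field_simp
    have hn : (n : ℝ) + 1 = k + 2 * i := by exact_mod_cast hi
    rw [h1, h2, hn]
    ring
  · push Not at h
    have h1 : (k : ℝ) * legendreExpCoeff n (k - 1) = 0 := by
      rcases k with _ | k
      · simp
      · rw [legendreExpCoeff_eq_zero fun i hi => h i (by omega), mul_zero]
    rw [legendreExpCoeff_eq_zero h, h1,
      legendreExpCoeff_eq_zero fun i hi => h (i + 1) (by omega)]
    simp

theorem pow_div_factorial_eq_sum (S : ℕ → ℂ) (c : ℂ) (h0 : S 0 = 1) (h1 : S 1 = c)
    (h2 : ∀ ℓ : ℕ, ((ℓ : ℂ) + 2) * S (ℓ + 2) = (2 * ℓ + 3) * c * S (ℓ + 1) - (ℓ + 1) * S ℓ)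
    (n : ℕ) : c ^ n / n.factorial =
      ∑ ℓ ∈ Finset.range (n + 1), (legendreExpCoeff n ℓ : ℂ) * ((2 * ℓ + 1) * S ℓ) := by
  have hc : ∀ ℓ : ℕ, c * ((2 * ℓ + 1) * S ℓ) = (ℓ + 1) * S (ℓ + 1) + ℓ * S (ℓ - 1) := by
    intro ℓ
    rcases ℓ with _ | ℓ
    · simp [h0, h1]
    · have := h2 ℓ
      rw [Nat.add_sub_cancel]
      push_cast
      linear_combination -this
  induction n with
  | zero =>
    have := legendreExpCoeff_add 0 0
    simp at this
    simp [h0, this]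
  | succ n ih =>
    have hn : ((n : ℂ) + 1) ≠ 0 := by exact_mod_cast n.succ_ne_zero
    have hnf : (n.factorial : ℂ) ≠ 0 := by exact_mod_cast n.factorial_ne_zero
    have hlhs : c ^ (n + 1) / ((n + 1).factorial : ℂ) = c * (c ^ n / n.factorial) / (n + 1) := by
      rw [Nat.factorial_succ, pow_succ']; push_cast; field_simp
    have hA : ∑ ℓ ∈ Finset.range (n + 1), (legendreExpCoeff n ℓ : ℂ) * ((ℓ + 1) * S (ℓ + 1)) =
        ∑ k ∈ Finset.range (n + 2), (k * legendreExpCoeff n (k - 1) : ℂ) * S k := by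
      rw [Finset.sum_range_succ' _ (n + 1)]
      simp only [Nat.add_sub_cancel, Nat.cast_zero, zero_mul, add_zero]
      exact Finset.sum_congr rfl fun k _ => by push_cast; ring
    have hB : ∑ ℓ ∈ Finset.range (n + 1), (legendreExpCoeff n ℓ : ℂ) * (ℓ * S (ℓ - 1)) =
        ∑ k ∈ Finset.range (n + 2), ((k + 1) * legendreExpCoeff n (k + 1) : ℂ) * S k := by
      rw [Finset.sum_range_succ' _ n, Finset.sum_range_succ _ (n + 1), Finset.sum_range_succ _ n,
        legendreExpCoeff_eq_zero (n := n) (ℓ := n + 1) (by omega),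
        legendreExpCoeff_eq_zero (n := n) (ℓ := n + 1 + 1) (by omega)]
      simp only [Nat.add_sub_cancel, Nat.cast_zero, zero_mul, mul_zero, add_zero,
        Complex.ofReal_zero]
      exact Finset.sum_congr rfl fun k _ => by push_cast; ring
    rw [hlhs, ih, div_eq_iff hn, Finset.mul_sum, Finset.sum_mul]
    calc _ = ∑ ℓ ∈ Finset.range (n + 1), (legendreExpCoeff n ℓ : ℂ) * ((ℓ + 1) * S (ℓ + 1)) +
          ∑ ℓ ∈ Finset.range (n + 1), (legendreExpCoeff n ℓ : ℂ) * (ℓ * S (ℓ - 1)) := by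
          rw [← Finset.sum_add_distrib]
          exact Finset.sum_congr rfl fun ℓ _ => by linear_combination (legendreExpCoeff n ℓ : ℂ) * hc ℓ
      _ = _ := by
          rw [hA, hB, ← Finset.sum_add_distrib]
          refine Finset.sum_congr rfl fun k _ => ?_
          have := congrArg (fun r : ℝ => (r : ℂ)) (legendreExpCoeff_recurrence n k)
          push_cast at this
          linear_combination -S k * this

/-- The factor `2ℓ + 1` is kept so that it cancels the multiplicity in the plane wave expansion. -/
theorem mul_factorial_le_doubleFactorial (ℓ i : ℕ) :
    (2 * ℓ + 1) * ℓ.factorial ≤ (2 * ℓ + 2 * i + 1).doubleFactorial := by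
  induction i with
  | zero =>
    rw [mul_zero, add_zero, Nat.doubleFactorial_add_one]
    refine Nat.mul_le_mul_left _ ?_
    induction ℓ with
    | zero => simp
    | succ k ih =>
      rw [show 2 * (k + 1) - 1 = 2 * k + 1 by omega, Nat.doubleFactorial_add_one,
        Nat.factorial_succ]
      exact Nat.mul_le_mul (by omega) ih
  | succ i ih =>
    rw [show 2 * ℓ + 2 * (i + 1) + 1 = 2 * ℓ + 2 * i + 1 + 2 by ring, Nat.doubleFactorial_add_two]
    exact ih.trans (Nat.le_mul_of_pos_left _ (by omega))

theorem legendreExpCoeff_add_nonneg (ℓ i : ℕ) : 0 ≤ legendreExpCoeff (ℓ + 2 * i) ℓ := by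
  rw [legendreExpCoeff_add]; positivity

theorem mul_legendreExpCoeff_add_le (ℓ i : ℕ) :
    (2 * (ℓ : ℝ) + 1) * legendreExpCoeff (ℓ + 2 * i) ℓ ≤
      1 / (ℓ.factorial : ℝ) * (1 / (i.factorial : ℝ)) := by
  have h1 : (2 * (ℓ : ℝ) + 1) * ℓ.factorial ≤ ((2 * ℓ + 2 * i + 1).doubleFactorial : ℝ) := by
    exact_mod_cast mul_factorial_le_doubleFactorial ℓ i
  have h2 : (i.factorial : ℝ) ≤ ((2 * i).doubleFactorial : ℝ) := by
    rw [Nat.doubleFactorial_two_mul]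
    exact_mod_cast Nat.le_mul_of_pos_left _ (by positivity)
  have h3 : (0 : ℝ) < i.factorial := by exact_mod_cast i.factorial_pos
  have h4 : (0 : ℝ) < ℓ.factorial := by exact_mod_cast ℓ.factorial_pos
  have h5 : (0 : ℝ) < ((2 * i).doubleFactorial : ℝ) := h3.trans_le h2
  have h6 : (0 : ℝ) < ((2 * ℓ + 2 * i + 1).doubleFactorial : ℝ) := by
    exact_mod_cast Nat.doubleFactorial_pos _
  rw [legendreExpCoeff_add, ← mul_div_assoc, mul_one, one_div_mul_one_div_rev,
    div_le_div_iff₀ (by positivity) (by positivity), one_mul]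
  calc (2 * (ℓ : ℝ) + 1) * (i.factorial * ℓ.factorial) =
      i.factorial * ((2 * (ℓ : ℝ) + 1) * ℓ.factorial) := by ring
    _ ≤ _ := by gcongr

/-- The spherical Bessel function `√(π / (2 x)) J_{ℓ+1/2}(x)`. -/
noncomputable def sphBessel (ℓ : ℕ) (x : ℝ) : ℝ :=
  ∑' i : ℕ, (-1) ^ i * legendreExpCoeff (ℓ + 2 * i) ℓ * x ^ (ℓ + 2 * i)

theorem two_pi_rpow : (2 * Real.pi) ^ (3 / 2 : ℝ) = 4 * Real.pi * (√2 * √Real.pi / 2) := by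
  have h : (0 : ℝ) < 2 * Real.pi := Real.two_pi_pos
  rw [show (3 / 2 : ℝ) = 1 + 1 / 2 by norm_num, Real.rpow_add h, Real.rpow_one,
    ← Real.sqrt_eq_rpow, Real.sqrt_mul (by norm_num)]
  ring

/-- The two power series agree termwise because `Γ` at half-integers is a double factorial times
`√π`. -/
theorem besselRadial_eq_sphBessel (ℓ : ℕ) (x : ℝ) (hx : 0 ≤ x) :
    (2 * Real.pi) ^ (3 / 2 : ℝ) * besselRadial ℓ x = 4 * Real.pi * sphBessel ℓ x := by
  have hpi := Real.pi_pos
  rw [two_pi_rpow, mul_assoc]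
  congr 1
  rcases hx.eq_or_lt with hx0 | hx0
  · subst hx0
    rw [besselRadial, if_pos rfl, sphBessel]
    rcases ℓ with _ | ℓ
    · rw [if_pos rfl, tsum_eq_single 0 fun i hi => by simp [hi], legendreExpCoeff_add]
      simp only [pow_zero, mul_zero, add_zero, Nat.doubleFactorial, Nat.cast_one, mul_one, div_one]
      rw [Real.sqrt_div (by norm_num)]
      have h2 : √2 * √2 = (2 : ℝ) := Real.mul_self_sqrt (by norm_num)
      field_simp
      linarith
    · rw [if_neg (by omega), mul_zero]
      simp
  · have hsx : 0 < √x := Real.sqrt_pos.mpr hx0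
    rw [besselRadial, if_neg hx0.ne', besselJ, sphBessel, ← tsum_div_const, ← tsum_mul_left]
    refine tsum_congr fun i => ?_
    have hG : Real.Gamma (i + ((ℓ : ℝ) + 1 / 2) + 1) =
        ((2 * ℓ + 2 * i + 1).doubleFactorial : ℝ) * √Real.pi / 2 ^ (i + ℓ + 1) := by
      have := Real.Gamma_nat_add_half (i + ℓ + 1)
      rw [show 2 * (i + ℓ + 1) - 1 = 2 * ℓ + 2 * i + 1 by omega] at this
      rw [← this]
      congr 1
      push_cast
      ring
    have hpow : (x / 2) ^ (2 * (i : ℝ) + ((ℓ : ℝ) + 1 / 2)) =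
        x ^ (ℓ + 2 * i) / 2 ^ (ℓ + 2 * i) * (√x / √2) := by
      rw [show 2 * (i : ℝ) + ((ℓ : ℝ) + 1 / 2) = ((ℓ + 2 * i : ℕ) : ℝ) + 1 / 2 by push_cast; ring,
        Real.rpow_add (by positivity), Real.rpow_natCast, ← Real.sqrt_eq_rpow,
        Real.sqrt_div hx, div_pow]
    have hdf : (0 : ℝ) < ((2 * ℓ + 2 * i + 1).doubleFactorial : ℝ) := by
      exact_mod_cast Nat.doubleFactorial_pos _
    have hif : (0 : ℝ) < i.factorial := by exact_mod_cast i.factorial_pos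
    have hspi : 0 < √Real.pi := Real.sqrt_pos.mpr hpi
    rw [hG, hpow, legendreExpCoeff_add, Nat.doubleFactorial_two_mul]
    push_cast
    rw [show (2 : ℝ) ^ (i + ℓ + 1) = 2 ^ i * 2 ^ ℓ * 2 by ring,
      show (2 : ℝ) ^ (ℓ + 2 * i) = 2 ^ ℓ * (2 ^ i) ^ 2 by ring]
    field_simp

/-- A bound for the terms of degree `ℓ` of the plane wave expansion. -/
noncomputable def planeWaveBound (x : ℝ) (ℓ : ℕ) : ℝ :=
  (3 * |x|) ^ ℓ / ℓ.factorial * Real.exp (x ^ 2)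

theorem summable_planeWaveBound (x : ℝ) : Summable (planeWaveBound x) :=
  (Real.summable_pow_div_factorial _).mul_right _

theorem norm_sphBessel_series_le (ℓ i : ℕ) (x : ℝ) :
    (2 * (ℓ : ℝ) + 1) * ‖(-1) ^ i * legendreExpCoeff (ℓ + 2 * i) ℓ * x ^ (ℓ + 2 * i)‖ ≤
      |x| ^ ℓ / ℓ.factorial * ((x ^ 2) ^ i / i.factorial) := by
  rw [norm_mul, norm_mul, norm_pow, norm_neg, norm_one, one_pow, one_mul, norm_pow,
    Real.norm_of_nonneg (legendreExpCoeff_add_nonneg ℓ i), Real.norm_eq_abs, ← mul_assoc]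
  calc _ ≤ 1 / (ℓ.factorial : ℝ) * (1 / (i.factorial : ℝ)) * |x| ^ (ℓ + 2 * i) := by
        exact mul_le_mul_of_nonneg_right (mul_legendreExpCoeff_add_le ℓ i) (by positivity)
    _ = _ := by rw [pow_add, pow_mul, sq_abs]; ring

theorem hasSum_sphBessel (ℓ : ℕ) (x : ℝ) :
    HasSum (fun i : ℕ => (-1) ^ i * legendreExpCoeff (ℓ + 2 * i) ℓ * x ^ (ℓ + 2 * i))
      (sphBessel ℓ x) := by
  refine Summable.hasSum (Summable.of_norm_bounded
    (g := fun i : ℕ => |x| ^ ℓ / ℓ.factorial * ((x ^ 2) ^ i / i.factorial))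
    ((Real.summable_pow_div_factorial _).mul_left _) fun i => ?_)
  refine le_trans ?_ (norm_sphBessel_series_le ℓ i x)
  exact le_mul_of_one_le_left (norm_nonneg _) (by linarith [Nat.cast_nonneg (α := ℝ) ℓ])

theorem mul_abs_sphBessel_le (ℓ : ℕ) (x : ℝ) :
    (2 * (ℓ : ℝ) + 1) * |sphBessel ℓ x| ≤ |x| ^ ℓ / ℓ.factorial * Real.exp (x ^ 2) := by
  have he : HasSum (fun i : ℕ => |x| ^ ℓ / ℓ.factorial * ((x ^ 2) ^ i / i.factorial))
      (|x| ^ ℓ / ℓ.factorial * Real.exp (x ^ 2)) := by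
    rw [Real.exp_eq_exp_ℝ]
    exact (NormedSpace.expSeries_div_hasSum_exp (x ^ 2)).mul_left _
  have h := (hasSum_sphBessel ℓ x).mul_left (2 * (ℓ : ℝ) + 1)
  have hb := tsum_of_norm_bounded he (f := fun i => (2 * (ℓ : ℝ) + 1) *
    ((-1) ^ i * legendreExpCoeff (ℓ + 2 * i) ℓ * x ^ (ℓ + 2 * i))) fun i => by
      rw [norm_mul, Real.norm_of_nonneg (by positivity : 0 ≤ 2 * (ℓ : ℝ) + 1)]
      exact norm_sphBessel_series_le ℓ i x
  rwa [h.tsum_eq, norm_mul, Real.norm_of_nonneg (by positivity : 0 ≤ 2 * (ℓ : ℝ) + 1),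
    Real.norm_eq_abs] at hb

theorem norm_planeWave_term_le (ℓ : ℕ) (x : ℝ) (s : ℂ) (hs : ‖s‖ ≤ 3 ^ ℓ) :
    ‖(2 * (ℓ : ℂ) + 1) * (-Complex.I) ^ ℓ * sphBessel ℓ x * s‖ ≤ planeWaveBound x ℓ := by
  have e2 : ‖(2 * (ℓ : ℂ) + 1)‖ = 2 * ℓ + 1 := by
    rw [show (2 * (ℓ : ℂ) + 1) = ((2 * ℓ + 1 : ℝ) : ℂ) by push_cast; ring, Complex.norm_real,
      Real.norm_of_nonneg (by positivity)]
  rw [norm_mul, norm_mul, norm_mul, e2, norm_pow, norm_neg, Complex.norm_I, one_pow, mul_one,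
    Complex.norm_real, Real.norm_eq_abs, planeWaveBound, mul_pow]
  calc _ ≤ |x| ^ ℓ / ℓ.factorial * Real.exp (x ^ 2) * 3 ^ ℓ := by
        exact mul_le_mul (mul_abs_sphBessel_le ℓ x) hs (norm_nonneg _) (by positivity)
    _ = _ := by ring

/-- The terms of the plane wave expansion, with the Bessel functions expanded. -/
noncomputable def planeWaveDoubleTerm (S : ℕ → ℂ) (x : ℝ) (p : ℕ × ℕ) : ℂ :=
  (2 * (p.1 : ℂ) + 1) * (-Complex.I) ^ p.1 *
    (((-1) ^ p.2 * legendreExpCoeff (p.1 + 2 * p.2) p.1 * x ^ (p.1 + 2 * p.2) : ℝ) : ℂ) * S p.1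

theorem summable_planeWaveDoubleTerm (S : ℕ → ℂ) (hS : ∀ ℓ, ‖S ℓ‖ ≤ 3 ^ ℓ) (x : ℝ) :
    Summable (planeWaveDoubleTerm S x) := by
  have hs : Summable fun p : ℕ × ℕ => (3 * |x|) ^ p.1 / p.1.factorial *
      ((x ^ 2) ^ p.2 / p.2.factorial) :=
    (Real.summable_pow_div_factorial _).mul_of_nonneg (Real.summable_pow_div_factorial _)
      (fun i => by positivity) (fun i => by positivity)
  refine Summable.of_norm_bounded hs ?_
  rintro ⟨ℓ, i⟩
  have e2 : ‖(2 * (ℓ : ℂ) + 1)‖ = 2 * ℓ + 1 := by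
    rw [show (2 * (ℓ : ℂ) + 1) = ((2 * ℓ + 1 : ℝ) : ℂ) by push_cast; ring, Complex.norm_real,
      Real.norm_of_nonneg (by positivity)]
  simp only [planeWaveDoubleTerm]
  rw [norm_mul, norm_mul, norm_mul, e2, norm_pow, norm_neg, Complex.norm_I, one_pow, mul_one,
    Complex.norm_real, mul_pow]
  calc _ ≤ |x| ^ ℓ / ℓ.factorial * ((x ^ 2) ^ i / i.factorial) * 3 ^ ℓ := by
        exact mul_le_mul (norm_sphBessel_series_le ℓ i x) (hS ℓ) (norm_nonneg _) (by positivity)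
    _ = _ := by ring

/-- The plane wave expansion, for any sequence satisfying the recurrence of the Legendre
polynomials. -/
theorem hasSum_planeWave (S : ℕ → ℂ) (c : ℂ) (h0 : S 0 = 1) (h1 : S 1 = c)
    (h2 : ∀ ℓ : ℕ, ((ℓ : ℂ) + 2) * S (ℓ + 2) = (2 * ℓ + 3) * c * S (ℓ + 1) - (ℓ + 1) * S ℓ)
    (hS : ∀ ℓ, ‖S ℓ‖ ≤ 3 ^ ℓ) (x : ℝ) :
    HasSum (fun ℓ : ℕ => (2 * (ℓ : ℂ) + 1) * (-Complex.I) ^ ℓ * sphBessel ℓ x * S ℓ)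
      (Complex.exp (-Complex.I * x * c)) := by
  have hFG : ∀ p : ℕ × ℕ, (-Complex.I * x) ^ (p.1 + 2 * p.2) *
      ((legendreExpCoeff (p.1 + 2 * p.2) p.1 : ℂ) * ((2 * p.1 + 1) * S p.1)) =
      planeWaveDoubleTerm S x p := by
    rintro ⟨ℓ, i⟩
    simp only [planeWaveDoubleTerm]
    have hI : (-Complex.I) ^ (ℓ + 2 * i) = (-Complex.I) ^ ℓ * (-1) ^ i := by
      rw [pow_add, pow_mul, neg_sq, Complex.I_sq]
    rw [mul_pow, hI]
    push_cast
    ring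
  -- The double series embeds in the `(n, ℓ)` grid with `n = ℓ + 2i`, and coefficients vanish off
  -- the image. Summing over `ℓ` for fixed `n` gives the exponential series; summing over `i` for
  -- fixed `ℓ` gives the Bessel functions.
  have hinj : Function.Injective fun p : ℕ × ℕ => (p.1 + 2 * p.2, p.1) := by
    rintro ⟨ℓ, i⟩ ⟨ℓ', i'⟩ h
    simp only [Prod.mk.injEq] at h ⊢
    omega
  have hGs := summable_planeWaveDoubleTerm S hS x
  have hFs : HasSum (fun p : ℕ × ℕ => (-Complex.I * x) ^ p.1 *
      ((legendreExpCoeff p.1 p.2 : ℂ) * ((2 * p.2 + 1) * S p.2)))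
      (∑' p, planeWaveDoubleTerm S x p) := by
    refine (hinj.hasSum_iff ?_).mp ?_
    · rintro ⟨n, ℓ⟩ hn
      have : legendreExpCoeff n ℓ = 0 := legendreExpCoeff_eq_zero fun i hi =>
        hn ⟨(ℓ, i), by simp [hi]⟩
      simp [this]
    · exact hGs.hasSum.congr_fun hFG
  have hrow : ∀ n : ℕ, HasSum (fun ℓ : ℕ => (-Complex.I * x) ^ n *
      ((legendreExpCoeff n ℓ : ℂ) * ((2 * ℓ + 1) * S ℓ)))
      ((-Complex.I * x * c) ^ n / n.factorial) := by
    intro n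
    rw [mul_pow (-Complex.I * (x : ℂ)) c n, mul_div_assoc, pow_div_factorial_eq_sum S c h0 h1 h2 n, Finset.mul_sum]
    refine hasSum_sum_of_ne_finset_zero fun ℓ hℓ => ?_
    have : legendreExpCoeff n ℓ = 0 := legendreExpCoeff_eq_zero fun i hi => hℓ (by
      rw [Finset.mem_range]; omega)
    simp [this]
  have hexp : ∑' p, planeWaveDoubleTerm S x p = Complex.exp (-Complex.I * x * c) := by
    have he : HasSum (fun n : ℕ => (-Complex.I * x * c) ^ n / n.factorial)
        (Complex.exp (-Complex.I * x * c)) := by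
      rw [Complex.exp_eq_exp_ℂ]
      exact NormedSpace.expSeries_div_hasSum_exp _
    exact (HasSum.prod_fiberwise hFs hrow).unique he
  rw [← hexp]
  have hcol : ∀ ℓ : ℕ, HasSum (fun i => planeWaveDoubleTerm S x (ℓ, i))
      ((2 * (ℓ : ℂ) + 1) * (-Complex.I) ^ ℓ * sphBessel ℓ x * S ℓ) := by
    intro ℓ
    have h : HasSum (fun i : ℕ => (((-1) ^ i * legendreExpCoeff (ℓ + 2 * i) ℓ *
        x ^ (ℓ + 2 * i) : ℝ) : ℂ)) (sphBessel ℓ x : ℂ) :=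
      Complex.hasSum_ofReal.mpr (hasSum_sphBessel ℓ x)
    simp only [planeWaveDoubleTerm]
    exact (h.mul_left _).mul_right _
  exact HasSum.prod_fiberwise hGs.hasSum hcol

theorem hasSum_zonalKernel (φ' θ' φ θ x : ℝ) :
    HasSum (fun ℓ : ℕ => (2 * (ℓ : ℂ) + 1) * (-Complex.I) ^ ℓ * sphBessel ℓ x *
      zonalKernel ℓ φ' θ' φ θ) (Complex.exp (-Complex.I * x * cosAngle φ' θ' φ θ)) :=
  hasSum_planeWave _ _ (zonalKernel_zero φ' θ' φ θ) (zonalKernel_one φ' θ' φ θ)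
    (fun ℓ => zonalKernel_add_two ℓ φ' θ' φ θ) (fun ℓ => norm_zonalKernel_le ℓ φ' θ' φ θ) x

theorem sphBessel_zero_eq_sinc (x : ℝ) : sphBessel 0 x = Real.sinc x := by
  by_cases hx : x = 0
  · subst hx
    rw [sphBessel, tsum_eq_single 0 fun i hi => by simp [hi], legendreExpCoeff_add]
    simp
  · rw [Real.sinc_of_ne_zero hx, eq_div_iff hx, mul_comm]
    refine ((hasSum_sphBessel 0 x).mul_left x).unique ((Real.hasSum_sin x).congr_fun fun i => ?_)
    rw [legendreExpCoeff_add, Nat.factorial_eq_mul_doubleFactorial]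
    simp only [zero_add, mul_zero]
    push_cast
    have h1 : (0 : ℝ) < ((2 * i).doubleFactorial : ℝ) := by exact_mod_cast Nat.doubleFactorial_pos _
    have h2 : (0 : ℝ) < ((2 * i + 1).doubleFactorial : ℝ) := by
      exact_mod_cast Nat.doubleFactorial_pos _
    field_simp
    ring

/-! ### Integration over the angles -/

/-- Lebesgue measure on the rectangle `[0, 2π] × [0, π]` of angles. -/
noncomputable def angMeasure : Measure (ℝ × ℝ) :=
  volume.restrict (Set.Icc 0 (2 * Real.pi) ×ˢ Set.Icc 0 Real.pi)

theorem measurableSet_angRect :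
    MeasurableSet (Set.Icc (0 : ℝ) (2 * Real.pi) ×ˢ Set.Icc (0 : ℝ) Real.pi) :=
  measurableSet_Icc.prod measurableSet_Icc

theorem isCompact_angRect :
    IsCompact (Set.Icc (0 : ℝ) (2 * Real.pi) ×ˢ Set.Icc (0 : ℝ) Real.pi) :=
  isCompact_Icc.prod isCompact_Icc

theorem integrable_angMeasure {E : Type*} [NormedAddCommGroup E] {f : ℝ × ℝ → E}
    (hf : Continuous f) : Integrable f angMeasure :=
  hf.continuousOn.integrableOn_compact isCompact_angRect

theorem integral_angMeasure_mul (f g : ℝ → ℂ) :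
    ∫ p, f p.1 * g p.2 ∂angMeasure =
      (∫ φ in (0 : ℝ)..(2 * Real.pi), f φ) * ∫ θ in (0 : ℝ)..Real.pi, g θ := by
  rw [angMeasure, Measure.volume_eq_prod, setIntegral_prod_mul,
    intervalIntegral.integral_of_le Real.two_pi_pos.le,
    intervalIntegral.integral_of_le Real.pi_pos.le, integral_Icc_eq_integral_Ioc,
    integral_Icc_eq_integral_Ioc]

theorem integral_angMeasure_iterated (G : ℝ → ℝ → ℂ) (hG : Continuous (Function.uncurry G)) :
    ∫ p, G p.1 p.2 ∂angMeasure =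
      ∫ φ in (0 : ℝ)..(2 * Real.pi), ∫ θ in (0 : ℝ)..Real.pi, G φ θ := by
  have hint : IntegrableOn (Function.uncurry G)
      (Set.Icc (0 : ℝ) (2 * Real.pi) ×ˢ Set.Icc (0 : ℝ) Real.pi) (volume.prod volume) := by
    rw [← Measure.volume_eq_prod]
    exact integrable_angMeasure hG
  rw [angMeasure, Measure.volume_eq_prod]
  refine (setIntegral_prod _ hint).trans ?_
  rw [intervalIntegral.integral_of_le Real.two_pi_pos.le, integral_Icc_eq_integral_Ioc]
  refine integral_congr_ae (Eventually.of_forall fun φ => ?_)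
  simp only [Function.uncurry]
  rw [intervalIntegral.integral_of_le Real.pi_pos.le, integral_Icc_eq_integral_Ioc]

theorem integral_sin_zero_pi : ∫ θ in (0 : ℝ)..Real.pi, (Real.sin θ : ℂ) = 2 := by
  rw [intervalIntegral.integral_ofReal, integral_sin]
  simp; norm_num

theorem integral_angMeasure_sin : ∫ p : ℝ × ℝ, (Real.sin p.2 : ℂ) ∂angMeasure = 4 * Real.pi := by
  have := integral_angMeasure_mul (fun _ => 1) (fun θ => (Real.sin θ : ℂ))
  simp only [one_mul] at this
  rw [this, integral_sin_zero_pi]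
  simp
  ring

theorem ae_angMeasure : ∀ᵐ p ∂angMeasure, p.2 ∈ Set.Icc 0 Real.pi :=
  (ae_restrict_mem measurableSet_angRect).mono fun _ hp => hp.2

theorem norm_integral_angMeasure_le (G : ℝ × ℝ → ℂ) (M : ℝ)
    (h : ∀ p, ‖G p‖ ≤ M) : ‖∫ p, G p * (Real.sin p.2 : ℂ) ∂angMeasure‖ ≤ 4 * Real.pi * M := by
  have hs : ∫ p : ℝ × ℝ, M * Real.sin p.2 ∂angMeasure = 4 * Real.pi * M := by
    have := integral_angMeasure_sin
    rw [integral_complex_ofReal] at this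
    rw [integral_const_mul, mul_comm]
    congr 1
    exact_mod_cast this
  rw [← hs]
  refine norm_integral_le_of_norm_le (integrable_angMeasure (by fun_prop)) ?_
  filter_upwards [ae_angMeasure] with p hp
  rw [norm_mul, Complex.norm_real, Real.norm_of_nonneg (Real.sin_nonneg_of_mem_Icc hp)]
  exact mul_le_mul_of_nonneg_right (h p) (Real.sin_nonneg_of_mem_Icc hp)

theorem continuous_zonalKernel (ℓ : ℕ) (φ' θ' : ℝ) :
    Continuous fun p : ℝ × ℝ => zonalKernel ℓ φ' θ' p.1 p.2 := by
  unfold zonalKernel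
  exact continuous_const.mul (continuous_finsetSum _ fun n _ =>
    continuous_const.mul (continuous_sphHarmPoly ℓ n))

/-- The plane wave expansion can be integrated termwise. -/
theorem hasSum_integral_zonalKernel (h : ℝ × ℝ → ℂ) (hh : Continuous h) (M : ℝ)
    (hM : ∀ p, ‖h p‖ ≤ M) (φ' θ' x : ℝ) :
    HasSum (fun ℓ : ℕ => ∫ p, h p * ((2 * (ℓ : ℂ) + 1) * (-Complex.I) ^ ℓ * sphBessel ℓ x *
      zonalKernel ℓ φ' θ' p.1 p.2) * (Real.sin p.2 : ℂ) ∂angMeasure)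
      (∫ p, h p * Complex.exp (-Complex.I * x * cosAngle φ' θ' p.1 p.2) *
        (Real.sin p.2 : ℂ) ∂angMeasure) := by
  have hc : ∀ ℓ : ℕ, Continuous fun p : ℝ × ℝ => h p * ((2 * (ℓ : ℂ) + 1) * (-Complex.I) ^ ℓ *
      sphBessel ℓ x * zonalKernel ℓ φ' θ' p.1 p.2) * (Real.sin p.2 : ℂ) := fun ℓ => by
    have := continuous_zonalKernel ℓ φ' θ'
    fun_prop
  have hM0 : 0 ≤ M := (norm_nonneg _).trans (hM 0)
  have hbound : ∀ (ℓ : ℕ) (p : ℝ × ℝ), ‖h p * ((2 * (ℓ : ℂ) + 1) * (-Complex.I) ^ ℓ *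
      sphBessel ℓ x * zonalKernel ℓ φ' θ' p.1 p.2) * (Real.sin p.2 : ℂ)‖ ≤
      M * planeWaveBound x ℓ := fun ℓ p => by
    have h1 := norm_planeWave_term_le ℓ x _ (norm_zonalKernel_le ℓ φ' θ' p.1 p.2)
    rw [norm_mul, norm_mul, Complex.norm_real]
    calc _ ≤ M * planeWaveBound x ℓ * 1 :=
          mul_le_mul (mul_le_mul (hM p) h1 (norm_nonneg _) hM0) (Real.abs_sin_le_one _)
            (abs_nonneg _) (mul_nonneg hM0 ((norm_nonneg _).trans h1))
      _ = _ := mul_one _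
  have key := hasSum_integral_of_summable_integral_norm (μ := angMeasure)
    (fun ℓ => integrable_angMeasure (hc ℓ)) (by
      refine Summable.of_nonneg_of_le (fun ℓ => integral_nonneg fun p => norm_nonneg _)
        (fun ℓ => ?_) (((summable_planeWaveBound x).mul_left M).mul_left (angMeasure.real Set.univ))
      refine (integral_mono (integrable_angMeasure (hc ℓ)).norm
        (integrable_angMeasure continuous_const) (hbound ℓ)).trans (le_of_eq ?_)
      rw [integral_const, smul_eq_mul])
  convert! key using 1
  refine integral_congr_ae (Eventually.of_forall fun p => ?_)
  exact (((hasSum_zonalKernel φ' θ' p.1 p.2 x).mul_left (h p)).mul_right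
    (Real.sin p.2 : ℂ)).tsum_eq.symm

theorem integral_exp_int_mul (m : ℤ) (hm : m ≠ 0) :
    ∫ φ in (0 : ℝ)..(2 * Real.pi), Complex.exp (Complex.I * (m : ℂ) * (φ : ℂ)) = 0 := by
  have hc : Complex.I * (m : ℂ) ≠ 0 := mul_ne_zero Complex.I_ne_zero (by exact_mod_cast hm)
  rw [integral_exp_mul_complex hc]
  have : Complex.exp (Complex.I * (m : ℂ) * ((2 * Real.pi : ℝ) : ℂ)) = 1 := by
    rw [← Complex.exp_int_mul_two_pi_mul_I m]
    congr 1
    push_cast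
    ring
  rw [this]
  simp

theorem harmCoeff_self (ℓ : ℕ) (θ : ℝ) (hθ : θ ∈ Set.Icc 0 Real.pi) :
    harmCoeff ℓ ℓ (Real.cos θ) (Real.sin θ) = (Polynomial.derivative^[ℓ]
      ((Polynomial.X ^ 2 - 1 : Polynomial ℝ) ^ ℓ)).eval (Real.cos θ) / ℓ.factorial := by
  have h := assocLegendre_eq_harmCoeff ℓ ℓ _ (Real.sin θ)
    (Real.sin_nonneg_of_mem_Icc hθ) (Real.cos_sq_add_sin_sq θ)
  have hf : (ℓ.factorial : ℝ) ≠ 0 := by exact_mod_cast ℓ.factorial_ne_zero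
  rw [sub_self, assocLegendre] at h
  simp only [zpow_zero, one_div, Int.cast_zero, zero_div, Real.rpow_zero, mul_one, add_zero,
    Int.toNat_natCast, one_mul] at h
  field_simp at h ⊢
  linarith

/-- After `x = cos θ` the integrand is the derivative of a polynomial still divisible by `x² - 1`,
so the boundary terms vanish. -/
theorem integral_harmCoeff_self (ℓ : ℕ) (hℓ : ℓ ≠ 0) :
    ∫ θ in (0 : ℝ)..Real.pi, harmCoeff ℓ ℓ (Real.cos θ) (Real.sin θ) * Real.sin θ = 0 := by
  set P : Polynomial ℝ := Polynomial.derivative^[ℓ - 1] ((Polynomial.X ^ 2 - 1) ^ ℓ) with hP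
  have hdvd : (Polynomial.X ^ 2 - 1 : Polynomial ℝ) ∣ P := by
    have := Polynomial.pow_sub_dvd_iterate_derivative_pow (Polynomial.X ^ 2 - 1 : Polynomial ℝ) ℓ
      (ℓ - 1)
    rwa [show ℓ - (ℓ - 1) = 1 by omega, pow_one] at this
  have hroot : ∀ x : ℝ, x ^ 2 = 1 → P.eval x = 0 := fun x hx => by
    obtain ⟨R, hR⟩ := hdvd
    rw [hR]; simp [hx]
  have hP' : Polynomial.derivative P =
      Polynomial.derivative^[ℓ] ((Polynomial.X ^ 2 - 1 : Polynomial ℝ) ^ ℓ) := by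
    rw [hP, ← Function.iterate_succ_apply' Polynomial.derivative,
      show (ℓ - 1).succ = ℓ by omega]
  have h1 : ∫ θ in (0 : ℝ)..Real.pi, harmCoeff ℓ ℓ (Real.cos θ) (Real.sin θ) * Real.sin θ =
      ∫ θ in (0 : ℝ)..Real.pi, (-(1 / (ℓ.factorial : ℝ))) *
        (P.derivative.eval (Real.cos θ) * -Real.sin θ) := by
    refine intervalIntegral.integral_congr fun θ hθ => ?_
    rw [Set.uIcc_of_le Real.pi_pos.le] at hθ
    rw [harmCoeff_self ℓ θ hθ, hP']
    ring
  rw [h1, intervalIntegral.integral_const_mul, intervalIntegral.integral_eq_sub_of_hasDerivAt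
    (f := fun θ => P.eval (Real.cos θ))
    (fun θ _ => (P.hasDerivAt _).comp θ (Real.hasDerivAt_cos θ))
    (Continuous.intervalIntegrable (by fun_prop) _ _)]
  rw [hroot _ (by simp), hroot _ (by simp)]
  simp

/-- Nonzero orders vanish in azimuth, order zero in the polar angle. Orthogonality to constants is
all that the spherical mean of a plane wave requires. -/
theorem integral_sphHarmPoly (ℓ n : ℕ) (hℓ : ℓ ≠ 0) :
    ∫ p, sphHarmPoly ℓ n p.1 p.2 * (Real.sin p.2 : ℂ) ∂angMeasure = 0 := by
  set A : ℝ := √((2 * (ℓ : ℝ) + 1) / (4 * Real.pi) *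
      (((2 * ℓ - n).factorial : ℝ) / (n.factorial : ℝ)))
  set B : ℝ := (-1) ^ ((n : ℤ) - ℓ) * (n.factorial : ℝ) / (2 ^ ℓ * (ℓ.factorial : ℝ))
  have h : ∀ p : ℝ × ℝ, sphHarmPoly ℓ n p.1 p.2 * (Real.sin p.2 : ℂ) =
      Complex.exp (Complex.I * (((n : ℤ) - ℓ : ℤ) : ℂ) * (p.1 : ℂ)) *
      ((A * B * (harmCoeff ℓ n (Real.cos p.2) (Real.sin p.2) * Real.sin p.2) : ℝ) : ℂ) := fun p => by
    simp only [sphHarmPoly, A, B]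
    push_cast
    ring
  simp only [h]
  rw [integral_angMeasure_mul (fun φ => Complex.exp (Complex.I * (((n : ℤ) - ℓ : ℤ) : ℂ) * (φ : ℂ)))
    (fun θ => ((A * B * (harmCoeff ℓ n (Real.cos θ) (Real.sin θ) * Real.sin θ) : ℝ) : ℂ))]
  by_cases hn : n = ℓ
  · subst hn
    rw [intervalIntegral.integral_ofReal, intervalIntegral.integral_const_mul,
      integral_harmCoeff_self n hℓ]
    simp
  · rw [integral_exp_int_mul _ (by omega), zero_mul]

theorem integral_zonalKernel (ℓ : ℕ) (hℓ : ℓ ≠ 0) (φ' θ' : ℝ) :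
    ∫ p, zonalKernel ℓ φ' θ' p.1 p.2 * (Real.sin p.2 : ℂ) ∂angMeasure = 0 := by
  have h : ∀ p : ℝ × ℝ, zonalKernel ℓ φ' θ' p.1 p.2 * (Real.sin p.2 : ℂ) =
      ∑ n ∈ Finset.range (2 * ℓ + 1), (4 * Real.pi / (2 * ℓ + 1) * star (sphHarmPoly ℓ n φ' θ')) *
        (sphHarmPoly ℓ n p.1 p.2 * (Real.sin p.2 : ℂ)) := fun p => by
    rw [zonalKernel, Finset.mul_sum, Finset.sum_mul]
    exact Finset.sum_congr rfl fun n _ => by ring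
  simp only [h]
  rw [integral_finsetSum]
  · exact Finset.sum_eq_zero fun n _ => by
      rw [integral_const_mul, integral_sphHarmPoly ℓ n hℓ, mul_zero]
  · intro n _
    have := continuous_sphHarmPoly ℓ n
    exact (integrable_angMeasure (this.mul (by fun_prop))).const_mul _

/-- The spherical mean of a plane wave. -/
theorem integral_exp_cosAngle (φ' θ' x : ℝ) :
    ∫ p, Complex.exp (-Complex.I * x * cosAngle φ' θ' p.1 p.2) * (Real.sin p.2 : ℂ) ∂angMeasure =
      4 * Real.pi * Real.sinc x := by
  have h := hasSum_integral_zonalKernel (fun _ => 1) continuous_const 1 (fun _ => by simp) φ' θ' x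
  simp only [one_mul] at h
  refine h.unique ?_
  have h0 : ∫ p, ((2 * ((0 : ℕ) : ℂ) + 1) * (-Complex.I) ^ 0 * sphBessel 0 x *
      zonalKernel 0 φ' θ' p.1 p.2) * (Real.sin p.2 : ℂ) ∂angMeasure =
      4 * (Real.pi : ℂ) * (Real.sinc x : ℂ) := by
    simp only [zonalKernel_zero, pow_zero, Nat.cast_zero, mul_zero, zero_add, one_mul, mul_one]
    rw [integral_const_mul, integral_angMeasure_sin, sphBessel_zero_eq_sinc]
    ring
  rw [← h0]
  refine hasSum_single 0 fun ℓ hℓ => ?_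
  simp only [mul_assoc]
  have := integral_zonalKernel ℓ hℓ φ' θ'
  simp only [integral_const_mul, this, mul_zero]

/-! ### Geometry of the sphere -/

/-- The inner product of `v` with the direction of angles `φ`, `θ`. -/
noncomputable def dirInner (v : Space3) (φ θ : ℝ) : ℝ :=
  v 0 * (Real.sin θ * Real.cos φ) + v 1 * (Real.sin θ * Real.sin φ) + v 2 * Real.cos θ

theorem dirInner_sub (v w : Space3) (φ θ : ℝ) :
    dirInner (v - w) φ θ = dirInner v φ θ - dirInner w φ θ := by
  simp only [dirInner, PiLp.sub_apply]; ring

theorem norm_sq_space3 (v : Space3) : ‖v‖ ^ 2 = v 0 ^ 2 + v 1 ^ 2 + v 2 ^ 2 := by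
  rw [EuclideanSpace.norm_sq_eq, Fin.sum_univ_three]
  simp only [Real.norm_eq_abs, sq_abs]

theorem spherical_coordinates (v : Space3) :
    v 0 = ‖v‖ * (Real.sin (polarAngle v) * Real.cos (azimuth v)) ∧
    v 1 = ‖v‖ * (Real.sin (polarAngle v) * Real.sin (azimuth v)) ∧
    v 2 = ‖v‖ * Real.cos (polarAngle v) := by
  have hn := norm_sq_space3 v
  by_cases hv : ‖v‖ = 0
  · have hv0 : v = 0 := norm_eq_zero.mp hv
    subst hv0
    simp
  have hpos : 0 < ‖v‖ := lt_of_le_of_ne (norm_nonneg _) (Ne.symm hv)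
  have habs : |v 2| ≤ ‖v‖ := by
    rw [← abs_of_nonneg (norm_nonneg v), ← sq_le_sq]
    nlinarith [sq_nonneg (v 0), sq_nonneg (v 1)]
  have hb := abs_le.mp habs
  have hcos : Real.cos (polarAngle v) = v 2 / ‖v‖ := by
    rw [polarAngle, Real.cos_arccos]
    · rw [le_div_iff₀ hpos]; linarith
    · rw [div_le_iff₀ hpos]; linarith
  set ζ : ℂ := (v 0 : ℂ) + (v 1 : ℂ) * Complex.I with hζ
  have hsin : ‖v‖ * Real.sin (polarAngle v) = ‖ζ‖ := by
    have h1 : ‖ζ‖ ^ 2 = v 0 ^ 2 + v 1 ^ 2 := by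
      rw [Complex.sq_norm, hζ, Complex.normSq_add_mul_I]
    have h2 : (‖v‖ * Real.sin (polarAngle v)) ^ 2 = ‖ζ‖ ^ 2 := by
      rw [mul_pow, Real.sin_sq, hcos, h1]
      field_simp
      linarith
    exact (sq_eq_sq₀ (mul_nonneg hpos.le (Real.sin_nonneg_of_mem_Icc
      ⟨Real.arccos_nonneg _, Real.arccos_le_pi _⟩)) (norm_nonneg _)).mp h2
  refine ⟨?_, ?_, ?_⟩
  · rw [← mul_assoc, hsin, azimuth, Complex.norm_mul_cos_arg, hζ]; simp
  · rw [← mul_assoc, hsin, azimuth, Complex.norm_mul_sin_arg, hζ]; simp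
  · rw [hcos]; field_simp

theorem dirInner_eq (v : Space3) (φ θ : ℝ) :
    dirInner v φ θ = ‖v‖ * cosAngle (azimuth v) (polarAngle v) φ θ := by
  obtain ⟨h0, h1, h2⟩ := spherical_coordinates v
  rw [dirInner, cosAngle, Real.cos_sub, h0, h1, h2]
  generalize ‖v‖ = r
  generalize azimuth v = a
  generalize polarAngle v = b
  ring

theorem abs_dirInner_le (v : Space3) (φ θ : ℝ) : |dirInner v φ θ| ≤ ‖v‖ := by
  rw [dirInner_eq, abs_mul, abs_norm]
  exact mul_le_of_le_one_right (norm_nonneg _) (abs_cosAngle_le _ _ _ _)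

theorem integral_exp_dirInner (k : ℝ) (v : Space3) :
    ∫ p, Complex.exp (-Complex.I * (k * dirInner v p.1 p.2 : ℝ)) * (Real.sin p.2 : ℂ) ∂angMeasure =
      4 * Real.pi * Real.sinc (k * ‖v‖) := by
  rw [← integral_exp_cosAngle (azimuth v) (polarAngle v)]
  refine integral_congr_ae (Eventually.of_forall fun p => ?_)
  simp only [dirInner_eq]
  push_cast
  ring_nf

theorem dist_sphPoint_sq (X : Space3) (r φ θ : ℝ) (hr : 0 ≤ r) :
    dist X (sphPoint r φ θ) ^ 2 = ‖X‖ ^ 2 - 2 * r * dirInner X φ θ + r ^ 2 := by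
  have h1 := norm_sq_space3 (sphPoint r φ θ)
  rw [norm_sphPoint r φ θ hr] at h1
  rw [dist_eq_norm, norm_sq_space3, norm_sq_space3, h1, dirInner]
  simp [sphPoint]
  ring

theorem norm_exp_neg_I_mul_sub (a b : ℝ) :
    ‖Complex.exp (-Complex.I * (a : ℂ)) - Complex.exp (-Complex.I * (b : ℂ))‖ ≤ |a - b| := by
  have h : Complex.exp (-Complex.I * (a : ℂ)) - Complex.exp (-Complex.I * (b : ℂ)) =
      Complex.exp (-Complex.I * (b : ℂ)) * (Complex.exp (Complex.I * ((b - a : ℝ) : ℂ)) - 1) := by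
    rw [mul_sub, ← Complex.exp_add]
    push_cast
    ring_nf
  have h1 : ‖Complex.exp (-Complex.I * (b : ℂ))‖ = 1 := by
    rw [show -Complex.I * (b : ℂ) = ((-b : ℝ) : ℂ) * Complex.I by push_cast; ring,
      Complex.norm_exp_ofReal_mul_I]
  rw [h, norm_mul, h1, one_mul, abs_sub_comm]
  exact Real.norm_exp_I_mul_ofReal_sub_one_le

/-- The far-field approximation of the channel response. -/
theorem norm_farField_sub_le (lam r0 κ ε : ℝ) (hlam : 0 < lam) (hr0 : 0 < r0) (X : Space3)
    (hX : ‖X‖ ≤ κ * lam) (hXε : ‖X‖ / r0 ≤ ε) (hε : ε ≤ 1 / 2) (φ θ : ℝ) :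
    ‖((r0 / dist X (sphPoint r0 φ θ) : ℝ) : ℂ) *
        Complex.exp (-Complex.I * ((2 * Real.pi / lam * dist X (sphPoint r0 φ θ) : ℝ) : ℂ)) -
      Complex.exp (-Complex.I * ((2 * Real.pi / lam * (r0 - dirInner X φ θ) : ℝ) : ℂ))‖ ≤
      (2 + 2 * Real.pi * |κ|) * ε := by
  set d := dist X (sphPoint r0 φ θ) with hd
  set p := dirInner X φ θ with hp
  have hpi := Real.pi_pos
  have hXn := norm_nonneg X
  have hε0 : 0 ≤ ε := le_trans (by positivity) hXε
  have hXr : ‖X‖ ≤ ε * r0 := by rwa [div_le_iff₀ hr0] at hXε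
  have hXhalf : ‖X‖ ≤ r0 / 2 := hXr.trans (by nlinarith)
  have hd2 : d ^ 2 = ‖X‖ ^ 2 - 2 * r0 * p + r0 ^ 2 := dist_sphPoint_sq X r0 φ θ hr0.le
  have hp' := abs_le.mp (abs_dirInner_le X φ θ)
  rw [← hp] at hp'
  have hdr : |d - r0| ≤ ‖X‖ := by
    have h := abs_norm_sub_norm_le (X - sphPoint r0 φ θ) (-sphPoint r0 φ θ)
    rw [norm_neg, norm_sphPoint _ _ _ hr0.le, ← dist_eq_norm, sub_neg_eq_add, sub_add_cancel] at h
    exact h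
  have hdr' := abs_le.mp hdr
  have hdpos : r0 / 2 ≤ d := by linarith
  have hd0 : 0 < d := by linarith
  -- The difference of squares `d² - (r₀ - p)² = ‖X‖² - p²` lies in `[0, ‖X‖²]` and is divided by a
  -- sum of at least `r₀`.
  have hdiff : |d - (r0 - p)| ≤ ‖X‖ * ε := by
    have hfac : (d - (r0 - p)) * (d + (r0 - p)) = ‖X‖ ^ 2 - p ^ 2 := by nlinarith
    have hsum : r0 ≤ d + (r0 - p) := by linarith
    have hpp : p ^ 2 ≤ ‖X‖ ^ 2 := by
      rw [sq_le_sq, abs_of_nonneg hXn]; exact abs_le.mpr hp'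
    have hge : 0 ≤ d - (r0 - p) := by
      by_contra hneg
      push Not at hneg
      nlinarith
    rw [abs_of_nonneg hge]
    have h1 : (d - (r0 - p)) * r0 ≤ ‖X‖ * ε * r0 := by
      calc (d - (r0 - p)) * r0 ≤ (d - (r0 - p)) * (d + (r0 - p)) := by gcongr
        _ ≤ ‖X‖ * ‖X‖ := by rw [hfac]; nlinarith [sq_nonneg p]
        _ ≤ ‖X‖ * (ε * r0) := by gcongr
        _ = _ := by ring
    exact le_of_mul_le_mul_right h1 hr0
  have hE : ‖Complex.exp (-Complex.I * ((2 * Real.pi / lam * d : ℝ) : ℂ))‖ = 1 := by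
    rw [show -Complex.I * ((2 * Real.pi / lam * d : ℝ) : ℂ) =
      ((-(2 * Real.pi / lam * d) : ℝ) : ℂ) * Complex.I by push_cast; ring,
      Complex.norm_exp_ofReal_mul_I]
  -- `|r₀ - d| ≤ ‖X‖ ≤ ε r₀`, and `r₀ ≤ 2 d`.
  have hamp : |r0 / d - 1| ≤ 2 * ε := by
    rw [div_sub_one hd0.ne', abs_div, abs_of_pos hd0, div_le_iff₀ hd0, abs_sub_comm]
    nlinarith
  have hphase : |2 * Real.pi / lam * d - 2 * Real.pi / lam * (r0 - p)| ≤
      2 * Real.pi * |κ| * ε := by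
    rw [← mul_sub, abs_mul, abs_of_pos (by positivity : 0 < 2 * Real.pi / lam)]
    have hXk : ‖X‖ ≤ |κ| * lam := hX.trans (by gcongr; exact le_abs_self κ)
    calc _ ≤ 2 * Real.pi / lam * (|κ| * lam * ε) := by
          gcongr; exact hdiff.trans (by gcongr)
      _ = _ := by field_simp
  calc _ = ‖((r0 / d - 1 : ℝ) : ℂ) * Complex.exp (-Complex.I * ((2 * Real.pi / lam * d : ℝ) : ℂ)) +
        (Complex.exp (-Complex.I * ((2 * Real.pi / lam * d : ℝ) : ℂ)) -
        Complex.exp (-Complex.I * ((2 * Real.pi / lam * (r0 - p) : ℝ) : ℂ)))‖ := by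
        congr 1; push_cast; ring
    _ ≤ 2 * ε + 2 * Real.pi * |κ| * ε := by
        refine (norm_add_le _ _).trans (add_le_add ?_ ((norm_exp_neg_I_mul_sub _ _).trans hphase))
        rw [norm_mul, hE, mul_one, Complex.norm_real]
        exact hamp
    _ = _ := by ring

/-! ### The main lobe of the cardinal sine -/

theorem abs_sinc_le_of_two_le {x : ℝ} (hx : 2 ≤ x) : |Real.sinc x| ≤ 1 / 2 := by
  rw [Real.sinc_of_ne_zero (by linarith), abs_div, abs_of_pos (by linarith : 0 < x),
    div_le_iff₀ (by linarith)]
  linarith [Real.abs_sin_le_one x]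

theorem abs_sinc_le_of_le_one {x : ℝ} (hx0 : 0 ≤ x) (hx : x ≤ 1) : |Real.sinc x| ≤ 1 - x ^ 2 / 10 := by
  rcases hx0.eq_or_lt with h0 | h0
  · subst h0; simp
  have h1 : |x| ≤ 1 := by rwa [abs_of_pos h0]
  have h := (abs_le.mp (Real.sin_bound h1)).2
  rw [abs_of_pos h0] at h
  have hs : 0 ≤ Real.sin x := Real.sin_nonneg_of_nonneg_of_le_pi hx0 (by linarith [Real.pi_gt_three])
  rw [Real.sinc_of_ne_zero h0.ne', abs_of_nonneg (by positivity), div_le_iff₀ h0]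
  have h5 : x ^ 5 ≤ x ^ 3 := pow_le_pow_of_le_one hx0 hx (by norm_num)
  nlinarith [pow_pos h0 3]

/-- The identity `sinc x = sinc (x / 2) cos (x / 2)` carries the bound from `[0, 1]` to `[0, 2]`,
turning `1/10` into `1/40`. -/
theorem abs_sinc_le_of_le_two {x : ℝ} (hx0 : 0 ≤ x) (hx : x ≤ 2) : |Real.sinc x| ≤ 1 - x ^ 2 / 40 := by
  have h := abs_sinc_le_of_le_one (x := x / 2) (by linarith) (by linarith)
  have hhalf : Real.sinc x = Real.sinc (x / 2) * Real.cos (x / 2) := by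
    rcases hx0.eq_or_lt with h0 | h0
    · subst h0; simp
    rw [Real.sinc_of_ne_zero h0.ne', Real.sinc_of_ne_zero (by positivity)]
    have : Real.sin x = 2 * Real.sin (x / 2) * Real.cos (x / 2) := by
      rw [← Real.sin_two_mul]; ring_nf
    rw [this]
    field_simp
  rw [hhalf, abs_mul]
  calc _ ≤ |Real.sinc (x / 2)| * 1 := by gcongr; exact Real.abs_cos_le_one _
    _ ≤ 1 - x ^ 2 / 40 := by rw [mul_one]; linarith [h, (by ring : (x / 2) ^ 2 / 10 = x ^ 2 / 40)]

/-! ### The noiseless profile -/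

/-- The channel response on the sphere of radius `r0`, normalized to have modulus `1` for a
transmitter at the center. -/
noncomputable def nearField (lam r0 : ℝ) (X : Space3) (p : ℝ × ℝ) : ℂ :=
  ((r0 / dist X (sphPoint r0 p.1 p.2) : ℝ) : ℂ) *
    Complex.exp (-Complex.I * ((2 * Real.pi / lam * dist X (sphPoint r0 p.1 p.2) : ℝ) : ℂ))

theorem channel_sphPoint (lam r0 : ℝ) (hr0 : 0 < r0) (X : Space3) (p : ℝ × ℝ) :
    channel lam X (sphPoint r0 p.1 p.2) =
      ((1 / (√(4 * Real.pi) * r0) : ℝ) : ℂ) * nearField lam r0 X p := by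
  rw [channel, nearField, ← mul_assoc, ← Complex.ofReal_mul]
  congr 3
  field_simp

theorem half_le_dist_sphPoint (r0 : ℝ) (hr0 : 0 < r0) (X : Space3) (hX : ‖X‖ ≤ r0 / 2) (φ θ : ℝ) :
    r0 / 2 ≤ dist X (sphPoint r0 φ θ) := by
  have h := abs_norm_sub_norm_le (sphPoint r0 φ θ) X
  rw [norm_sphPoint _ _ _ hr0.le, ← dist_eq_norm, dist_comm] at h
  linarith [(abs_le.mp h).2]

theorem continuous_dist_sphPoint (r0 : ℝ) (hr0 : 0 < r0) (X : Space3) :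
    Continuous fun p : ℝ × ℝ => dist X (sphPoint r0 p.1 p.2) := by
  have h : ∀ p : ℝ × ℝ, dist X (sphPoint r0 p.1 p.2) =
      √(‖X‖ ^ 2 - 2 * r0 * dirInner X p.1 p.2 + r0 ^ 2) := fun p => by
    rw [← dist_sphPoint_sq X r0 _ _ hr0.le, Real.sqrt_sq dist_nonneg]
  simp only [h, dirInner]
  fun_prop

theorem continuous_nearField (lam r0 : ℝ) (hr0 : 0 < r0) (X : Space3) (hX : ‖X‖ ≤ r0 / 2) :
    Continuous (nearField lam r0 X) := by
  have hd := continuous_dist_sphPoint r0 hr0 X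
  have hne : ∀ p : ℝ × ℝ, dist X (sphPoint r0 p.1 p.2) ≠ 0 := fun p =>
    (lt_of_lt_of_le (by positivity) (half_le_dist_sphPoint r0 hr0 X hX p.1 p.2)).ne'
  have h1 : Continuous fun p : ℝ × ℝ => r0 / dist X (sphPoint r0 p.1 p.2) :=
    continuous_const.div hd hne
  unfold nearField
  fun_prop

theorem norm_exp_neg_I_mul (a : ℝ) : ‖Complex.exp (-Complex.I * (a : ℂ))‖ = 1 := by
  rw [show -Complex.I * (a : ℂ) = ((-a : ℝ) : ℂ) * Complex.I by push_cast; ring,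
    Complex.norm_exp_ofReal_mul_I]

theorem norm_nearField_le (lam r0 : ℝ) (hr0 : 0 < r0) (X : Space3) (hX : ‖X‖ ≤ r0 / 2)
    (p : ℝ × ℝ) : ‖nearField lam r0 X p‖ ≤ 2 := by
  have h := half_le_dist_sphPoint r0 hr0 X hX p.1 p.2
  have h0 : 0 < dist X (sphPoint r0 p.1 p.2) := lt_of_lt_of_le (by positivity) h
  rw [nearField, norm_mul, norm_exp_neg_I_mul, mul_one, Complex.norm_real,
    Real.norm_of_nonneg (by positivity), div_le_iff₀ h0]
  linarith

/-- The correlation of the channel response of `X` with the plane waves of the location `Y`. -/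
noncomputable def fieldCorrelation (lam r0 : ℝ) (X Y : Space3) : ℂ :=
  ∫ p, nearField lam r0 X p *
    Complex.exp (-Complex.I * ((2 * Real.pi / lam * dirInner Y p.1 p.2 : ℝ) : ℂ)) *
      (Real.sin p.2 : ℂ) ∂angMeasure

theorem continuous_dirInner (Y : Space3) : Continuous fun p : ℝ × ℝ => dirInner Y p.1 p.2 := by
  unfold dirInner; fun_prop

theorem continuous_fieldCorrelation (lam r0 : ℝ) (hr0 : 0 < r0) (X : Space3)
    (hX : ‖X‖ ≤ r0 / 2) : Continuous (fieldCorrelation lam r0 X) := by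
  have hc := continuous_nearField lam r0 hr0 X hX
  have hd : Continuous fun q : Space3 × (ℝ × ℝ) => dirInner q.1 q.2.1 q.2.2 := by
    unfold dirInner; fun_prop
  unfold fieldCorrelation angMeasure
  refine continuous_parametric_integral_of_continuous ?_ isCompact_angRect
  unfold Function.uncurry
  fun_prop

/-- In the far field the integrand is `exp(-i k r₀)` times a plane wave for `Y - X`. The constant
phase drops out of the modulus and the spherical mean of the plane wave is `sinc`. -/
theorem abs_norm_fieldCorrelation_sub_le (lam r0 κ ε : ℝ) (hlam : 0 < lam) (hr0 : 0 < r0)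
    (X : Space3) (hX : ‖X‖ ≤ κ * lam) (hXε : ‖X‖ / r0 ≤ ε) (hε : ε ≤ 1 / 2) (Y : Space3) :
    |1 / (4 * Real.pi) * ‖fieldCorrelation lam r0 X Y‖ -
      (|Real.sinc (2 * Real.pi / lam * dist X Y)|)| ≤ (2 + 2 * Real.pi * |κ|) * ε := by
  have hpi := Real.pi_pos
  have hXhalf : ‖X‖ ≤ r0 / 2 := by
    have := hXε.trans hε
    rw [div_le_iff₀ hr0] at this
    linarith
  set k := 2 * Real.pi / lam with hk
  set B : ℂ := ∫ p, Complex.exp (-Complex.I * ((k * (r0 - dirInner X p.1 p.2) : ℝ) : ℂ)) *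
    Complex.exp (-Complex.I * ((k * dirInner Y p.1 p.2 : ℝ) : ℂ)) *
      (Real.sin p.2 : ℂ) ∂angMeasure with hB
  have hBnorm : ‖B‖ = 4 * Real.pi * |Real.sinc (k * dist X Y)| := by
    have : B = Complex.exp (-Complex.I * ((k * r0 : ℝ) : ℂ)) *
        (4 * Real.pi * Real.sinc (k * ‖Y - X‖)) := by
      rw [← integral_exp_dirInner, ← integral_const_mul, hB]
      refine integral_congr_ae (Eventually.of_forall fun p => ?_)
      simp only
      rw [← Complex.exp_add, ← mul_assoc, ← Complex.exp_add, dirInner_sub]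
      congr 2
      push_cast
      ring
    rw [this, norm_mul, norm_exp_neg_I_mul, one_mul, dist_comm, dist_eq_norm, norm_mul, norm_mul,
      Complex.norm_real, Complex.norm_real, Real.norm_of_nonneg hpi.le, Real.norm_eq_abs]
    norm_num
  have hdiff : ‖fieldCorrelation lam r0 X Y - B‖ ≤
      4 * Real.pi * ((2 + 2 * Real.pi * |κ|) * ε) := by
    have hc := continuous_nearField lam r0 hr0 X hXhalf
    have hdX := continuous_dirInner X
    have hdY := continuous_dirInner Y
    have h1 : fieldCorrelation lam r0 X Y - B = ∫ p, (nearField lam r0 X p -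
        Complex.exp (-Complex.I * ((k * (r0 - dirInner X p.1 p.2) : ℝ) : ℂ))) *
        Complex.exp (-Complex.I * ((k * dirInner Y p.1 p.2 : ℝ) : ℂ)) *
        (Real.sin p.2 : ℂ) ∂angMeasure := by
      rw [fieldCorrelation, hB, ← integral_sub (integrable_angMeasure (by fun_prop))
        (integrable_angMeasure (by fun_prop))]
      refine integral_congr_ae (Eventually.of_forall fun p => ?_)
      simp only
      ring
    rw [h1]
    refine norm_integral_angMeasure_le _ _ fun p => ?_
    rw [norm_mul, norm_exp_neg_I_mul, mul_one]
    exact norm_farField_sub_le lam r0 κ ε hlam hr0 X hX hXε hε p.1 p.2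
  have h2 := (abs_norm_sub_norm_le (fieldCorrelation lam r0 X Y) B).trans hdiff
  rw [hBnorm] at h2
  have h3 : 1 / (4 * Real.pi) * ‖fieldCorrelation lam r0 X Y‖ - |Real.sinc (k * dist X Y)| =
      1 / (4 * Real.pi) * (‖fieldCorrelation lam r0 X Y‖ -
        4 * Real.pi * |Real.sinc (k * dist X Y)|) := by
    field_simp
  rw [h3, abs_mul, abs_of_pos (by positivity)]
  calc _ ≤ 1 / (4 * Real.pi) * (4 * Real.pi * ((2 + 2 * Real.pi * |κ|) * ε)) := by gcongr
    _ = _ := by field_simp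

/-! ### Laplace coefficients of the received signals -/

theorem sphereRiemannSum_add (F G : ℝ → ℝ → ℂ) (N : ℕ) :
    sphereRiemannSum (fun φ θ => F φ θ + G φ θ) N =
      sphereRiemannSum F N + sphereRiemannSum G N := by
  simp only [sphereRiemannSum, add_mul, Finset.sum_add_distrib]

theorem tendsto_sphereRiemannSum_mul_sphHarm (g : ℝ × ℝ → ℂ) (hg : Continuous g) (ℓ n : ℕ) :
    Tendsto (sphereRiemannSum fun φ θ => g (φ, θ) * sphHarm ℓ ((n : ℤ) - ℓ) φ θ) atTop
      (𝓝 (∫ p, g p * sphHarmPoly ℓ n p.1 p.2 * (Real.sin p.2 : ℂ) ∂angMeasure)) := by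
  have hs := continuous_sphHarmPoly ℓ n
  have hc : Continuous (Function.uncurry fun φ θ => g (φ, θ) * sphHarmPoly ℓ n φ θ) := hg.mul hs
  have hsin : Continuous fun p : ℝ × ℝ => (Real.sin p.2 : ℂ) := by fun_prop
  have h := tendsto_sphereRiemannSum
    (fun φ θ => g (φ, θ) * sphHarm ℓ ((n : ℤ) - ℓ) φ θ) (fun φ θ => g (φ, θ) * sphHarmPoly ℓ n φ θ)
    hc (fun φ θ hθ => congrArg (g (φ, θ) * ·) (sphHarm_eq_sphHarmPoly ℓ n φ θ hθ))
  have hc2 : Continuous (Function.uncurry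
      fun φ θ => g (φ, θ) * sphHarmPoly ℓ n φ θ * (Real.sin θ : ℂ)) := hc.mul hsin
  rwa [← integral_angMeasure_iterated _ hc2] at h

theorem exists_bound_sphHarm (ℓ n : ℕ) :
    ∃ M : ℝ, ∀ φ, ∀ θ ∈ Set.Icc 0 Real.pi, ‖sphHarm ℓ ((n : ℤ) - ℓ) φ θ‖ ≤ M := by
  have hc : Continuous (Function.uncurry (sphHarmPoly ℓ n) ∘ fun θ : ℝ => ((0 : ℝ), θ)) :=
    (continuous_sphHarmPoly ℓ n).comp (Continuous.prodMk_right 0)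
  obtain ⟨M, hM⟩ := (isCompact_Icc (a := (0 : ℝ)) (b := Real.pi)).exists_bound_of_continuousOn
    hc.continuousOn
  refine ⟨M, fun φ θ hθ => ?_⟩
  rw [sphHarm_eq_sphHarmPoly ℓ n φ θ hθ]
  have h : ‖sphHarmPoly ℓ n φ θ‖ = ‖sphHarmPoly ℓ n 0 θ‖ := by
    have he : ∀ φ : ℝ, ‖Complex.exp (Complex.I * (((n : ℤ) - ℓ : ℤ) : ℂ) * (φ : ℂ))‖ = 1 := by
      intro φ
      rw [show Complex.I * (((n : ℤ) - ℓ : ℤ) : ℂ) * (φ : ℂ) =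
        (((((n : ℤ) - ℓ : ℤ) : ℝ) * φ : ℝ) : ℂ) * Complex.I by push_cast; ring,
        Complex.norm_exp_ofReal_mul_I]
    rw [sphHarmPoly, sphHarmPoly, norm_mul, norm_mul, he, he]
  rw [h]
  exact hM θ hθ

/-- The indices `(t, ℓ, n)` are countable, so a single null set serves all of them. -/
theorem ae_tendsto_noise {Ω : Type*} [MeasurableSpace Ω] (P : Measure Ω)
    [IsProbabilityMeasure P] (r0 : ℝ) (hr0 : 0 < r0) (σ2 : NNReal) {L : ℕ}
    (z : Fin L → Space3 → Ω → ℂ) (hz : ∀ t, IsSpatiallyWhite P r0 σ2 (z t)) :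
    ∀ᵐ ω ∂P, ∀ (t : Fin L) (ℓ n : ℕ), Tendsto (sphereRiemannSum fun φ θ =>
      z t (sphPoint r0 φ θ) ω * sphHarm ℓ ((n : ℤ) - ℓ) φ θ) atTop (𝓝 0) := by
  rw [ae_all_iff]; intro t
  rw [ae_all_iff]; intro ℓ
  rw [ae_all_iff]; intro n
  obtain ⟨M, hM⟩ := exists_bound_sphHarm ℓ n
  exact ae_tendsto_sphereRiemannSum_noise P r0 hr0 σ2 (z t) (hz t) _ M hM

/-- The Laplace coefficient of the normalized channel response. -/
noncomputable def nearFieldCoeff (lam r0 : ℝ) (X : Space3) (ℓ n : ℕ) : ℂ :=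
  ∫ p, nearField lam r0 X p * sphHarmPoly ℓ n p.1 p.2 * (Real.sin p.2 : ℂ) ∂angMeasure

theorem tendsto_sphereRiemannSum_training (lam r0 : ℝ) (hr0 : 0 < r0) {U : ℕ}
    (X : Fin U → Space3) (hX : ∀ u, ‖X u‖ ≤ r0 / 2) (s : Fin U → ℂ) (z : Space3 → ℂ) (ℓ n : ℕ)
    (hz : Tendsto (sphereRiemannSum fun φ θ =>
      z (sphPoint r0 φ θ) * sphHarm ℓ ((n : ℤ) - ℓ) φ θ) atTop (𝓝 0)) :
    Tendsto (sphereRiemannSum (laplaceIntegrand r0 (trainingSignal lam X s z) ℓ ((n : ℤ) - ℓ)))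
      atTop (𝓝 (((lam / √(4 * Real.pi) : ℝ) : ℂ) * ((1 / (√(4 * Real.pi) * r0) : ℝ) : ℂ) *
        ∑ u, nearFieldCoeff lam r0 (X u) ℓ n * s u)) := by
  set a : ℂ := ((lam / √(4 * Real.pi) : ℝ) : ℂ)
  set b : ℂ := ((1 / (√(4 * Real.pi) * r0) : ℝ) : ℂ)
  set g : ℝ × ℝ → ℂ := fun p => a * b * ∑ u, nearField lam r0 (X u) p * s u with hg
  have hc : ∀ u, Continuous (nearField lam r0 (X u)) := fun u =>
    continuous_nearField lam r0 hr0 (X u) (hX u)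
  have hgc : Continuous g := continuous_const.mul (continuous_finsetSum _ fun u _ =>
    (hc u).mul continuous_const)
  have h1 := (tendsto_sphereRiemannSum_mul_sphHarm g hgc ℓ n).add hz
  rw [add_zero] at h1
  have hlim : ∫ p, g p * sphHarmPoly ℓ n p.1 p.2 * (Real.sin p.2 : ℂ) ∂angMeasure =
      a * b * ∑ u, nearFieldCoeff lam r0 (X u) ℓ n * s u := by
    have hs : Continuous fun p : ℝ × ℝ => sphHarmPoly ℓ n p.1 p.2 := continuous_sphHarmPoly ℓ n
    have h : ∀ p : ℝ × ℝ, g p * sphHarmPoly ℓ n p.1 p.2 * (Real.sin p.2 : ℂ) =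
        ∑ u, a * b * s u * (nearField lam r0 (X u) p * sphHarmPoly ℓ n p.1 p.2 *
          (Real.sin p.2 : ℂ)) := fun p => by
      simp only [hg]
      rw [Finset.mul_sum, Finset.sum_mul, Finset.sum_mul]
      exact Finset.sum_congr rfl fun u _ => by ring
    simp only [h]
    rw [integral_finsetSum _ fun u _ => (integrable_angMeasure (by
      have := hc u
      fun_prop)).const_mul _, Finset.mul_sum]
    exact Finset.sum_congr rfl fun u _ => by rw [integral_const_mul, nearFieldCoeff]; ring
  rw [hlim] at h1
  refine h1.congr fun N => ?_
  rw [← sphereRiemannSum_add]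
  congr 1
  funext φ θ
  have hch : ∀ u, channel lam (X u) (sphPoint r0 φ θ) = b * nearField lam r0 (X u) (φ, θ) :=
    fun u => channel_sphPoint lam r0 hr0 (X u) (φ, θ)
  rw [laplaceIntegrand, trainingSignal, ← add_mul]
  simp only [hch, hg]
  rw [mul_assoc a b, Finset.mul_sum (a := b)]
  simp only [mul_assoc]
  rfl

/-- Orthonormality cancels the other users exactly, leaving no interference term in the error. -/
theorem combinedCoeff_training (lam r0 : ℝ) (hr0 : 0 < r0) {U L : ℕ}
    (X : Fin U → Space3) (hX : ∀ u, ‖X u‖ ≤ r0 / 2) (s : Fin U → EuclideanSpace ℂ (Fin L))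
    (hs : Orthonormal ℂ s) (z : Fin L → Space3 → ℂ) (ℓ n : ℕ)
    (hz : ∀ t, Tendsto (sphereRiemannSum fun φ θ =>
      z t (sphPoint r0 φ θ) * sphHarm ℓ ((n : ℤ) - ℓ) φ θ) atTop (𝓝 0)) (u : Fin U) :
    combinedCoeff r0 (s u) (fun t => trainingSignal lam X (fun u => s u t) (z t)) ℓ ((n : ℤ) - ℓ) =
      ((lam / √(4 * Real.pi) : ℝ) : ℂ) * ((1 / (√(4 * Real.pi) * r0) : ℝ) : ℂ) *
        nearFieldCoeff lam r0 (X u) ℓ n := by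
  have horth : ∀ k, ∑ t, star (s u t) * s k t = if u = k then 1 else 0 := fun k => by
    have := (orthonormal_iff_ite.mp hs) u k
    rw [← this, PiLp.inner_apply]
    exact Finset.sum_congr rfl fun t _ => by
      rw [RCLike.inner_apply, mul_comm]; rfl
  have hcoef : ∀ t, laplaceCoeff r0 (trainingSignal lam X (fun u => s u t) (z t)) ℓ ((n : ℤ) - ℓ) =
      ((lam / √(4 * Real.pi) : ℝ) : ℂ) * ((1 / (√(4 * Real.pi) * r0) : ℝ) : ℂ) *
        ∑ k, nearFieldCoeff lam r0 (X k) ℓ n * s k t := fun t =>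
    (tendsto_sphereRiemannSum_training lam r0 hr0 X hX (fun u => s u t) (z t) ℓ n (hz t)).limUnder_eq
  simp only [combinedCoeff, hcoef]
  generalize ((lam / √(4 * Real.pi) : ℝ) : ℂ) * ((1 / (√(4 * Real.pi) * r0) : ℝ) : ℂ) = c
  calc _ = c * ∑ k, nearFieldCoeff lam r0 (X k) ℓ n * ∑ t, star (s u t) * s k t := by
        simp only [Finset.mul_sum]
        rw [Finset.sum_comm]
        exact Finset.sum_congr rfl fun k _ => Finset.sum_congr rfl fun t _ => by ring
    _ = _ := by simp only [horth, mul_ite, mul_one, mul_zero, Finset.sum_ite_eq, Finset.mem_univ, if_true]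

theorem hasSum_profileTerm (lam r0 : ℝ) (hlam : 0 < lam) (hr0 : 0 < r0) (X : Space3)
    (hX : ‖X‖ ≤ r0 / 2) (c : ℂ) (Q : ℕ → ℤ → ℂ)
    (hQ : ∀ ℓ n : ℕ, n ≤ 2 * ℓ → Q ℓ ((n : ℤ) - ℓ) = c * nearFieldCoeff lam r0 X ℓ n) (Y : Space3) :
    HasSum (profileTerm lam Y Q) (c * fieldCorrelation lam r0 X Y) := by
  have hc := continuous_nearField lam r0 hr0 X hX
  set x : ℝ := 2 * Real.pi / lam * ‖Y‖ with hx
  have hx0 : 0 ≤ x := by have := Real.pi_pos; positivity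
  have h := (hasSum_integral_zonalKernel (nearField lam r0 X) hc 2
    (norm_nearField_le lam r0 hr0 X hX) (azimuth Y) (polarAngle Y) x).mul_left c
  have hlim : ∫ p, nearField lam r0 X p *
      Complex.exp (-Complex.I * x * cosAngle (azimuth Y) (polarAngle Y) p.1 p.2) *
        (Real.sin p.2 : ℂ) ∂angMeasure = fieldCorrelation lam r0 X Y := by
    rw [fieldCorrelation]
    refine integral_congr_ae (Eventually.of_forall fun p => ?_)
    simp only [dirInner_eq, hx]
    push_cast
    ring_nf
  rw [hlim] at h
  refine h.congr_fun fun ℓ => ?_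
  have hl : (2 * (ℓ : ℂ) + 1) ≠ 0 := by exact_mod_cast (by omega : 2 * ℓ + 1 ≠ 0)
  have hpol : polarAngle Y ∈ Set.Icc 0 Real.pi := ⟨Real.arccos_nonneg _, Real.arccos_le_pi _⟩
  -- Conjugation turns `i ^ ℓ` into `(-i) ^ ℓ`, the sign of the expansion of `exp(-i k ⟨Y, n⟩)`.
  have hsig : ∀ n : ℕ, star (locSignature lam Y ℓ ((n : ℤ) - ℓ)) =
      4 * Real.pi * sphBessel ℓ x * (-Complex.I) ^ ℓ *
        star (sphHarmPoly ℓ n (azimuth Y) (polarAngle Y)) := fun n => by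
    rw [locSignature, besselRadial_eq_sphBessel ℓ _ hx0, sphHarm_eq_sphHarmPoly ℓ n _ _ hpol,
      star_mul', star_mul', star_pow, Complex.star_def, Complex.conj_I,
      Complex.conj_ofReal]
    push_cast
    rfl
  have hs : ∀ n, Continuous fun p : ℝ × ℝ => sphHarmPoly ℓ n p.1 p.2 := continuous_sphHarmPoly ℓ
  rw [profileTerm, sum_Icc_neg_eq_sum_range]
  calc _ = ∑ n ∈ Finset.range (2 * ℓ + 1), 4 * Real.pi * sphBessel ℓ x * (-Complex.I) ^ ℓ *
        star (sphHarmPoly ℓ n (azimuth Y) (polarAngle Y)) * c * nearFieldCoeff lam r0 X ℓ n :=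
        Finset.sum_congr rfl fun n hn => by
          rw [hQ ℓ n (by simpa [Nat.lt_succ_iff] using hn), hsig]; ring
    _ = ∫ p, ∑ n ∈ Finset.range (2 * ℓ + 1), 4 * Real.pi * sphBessel ℓ x * (-Complex.I) ^ ℓ *
        star (sphHarmPoly ℓ n (azimuth Y) (polarAngle Y)) * c * (nearField lam r0 X p *
          sphHarmPoly ℓ n p.1 p.2 * (Real.sin p.2 : ℂ)) ∂angMeasure := by
        rw [integral_finsetSum _ fun n _ => (integrable_angMeasure (by
          have := hs n
          fun_prop)).const_mul _]
        exact Finset.sum_congr rfl fun n _ => by rw [integral_const_mul, nearFieldCoeff]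
    _ = _ := by
        rw [← integral_const_mul]
        refine integral_congr_ae (Eventually.of_forall fun p => ?_)
        simp only [zonalKernel, Finset.mul_sum, Finset.sum_mul]
        refine Finset.sum_congr rfl fun n _ => ?_
        field_simp

theorem profile_eq (lam r0 : ℝ) (hlam : 0 < lam) (hr0 : 0 < r0) (X : Space3)
    (hX : ‖X‖ ≤ r0 / 2) (Q : ℕ → ℤ → ℂ)
    (hQ : ∀ ℓ n : ℕ, n ≤ 2 * ℓ → Q ℓ ((n : ℤ) - ℓ) = ((lam / √(4 * Real.pi) : ℝ) : ℂ) *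
      ((1 / (√(4 * Real.pi) * r0) : ℝ) : ℂ) * nearFieldCoeff lam r0 X ℓ n) (Y : Space3) :
    profile lam r0 Q Y = 1 / (4 * Real.pi) * ‖fieldCorrelation lam r0 X Y‖ := by
  have hpi := Real.pi_pos
  rw [profile, (hasSum_profileTerm lam r0 hlam hr0 X hX _ Q hQ Y).tsum_eq, norm_mul,
    ← Complex.ofReal_mul, Complex.norm_real, Real.norm_of_nonneg (by positivity), ← mul_assoc]
  congr 1
  have h : √(4 * Real.pi) * √(4 * Real.pi) = 4 * Real.pi := Real.mul_self_sqrt (by positivity)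
  calc _ = 1 / (√(4 * Real.pi) * √(4 * Real.pi)) := by field_simp
    _ = _ := by rw [h]

/-! ### The peak of a profile close to the cardinal sine -/

/-- `F X ≥ 7/8`, while `F ≤ 5/8` at distance at least `2 / k`; continuity on the remaining compact
ball gives the maximum. -/
theorem exists_max_of_abs_sub_sinc_le (F : Space3 → ℝ) (hF : Continuous F) (X : Space3) (k e : ℝ)
    (hk : 0 < k) (he : e ≤ 1 / 8)
    (h : ∀ Y, |F Y - (|Real.sinc (k * dist X Y)|)| ≤ e) : ∃ Z, ∀ Y, F Y ≤ F Z := by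
  refine hF.exists_forall_ge' X ?_
  have hX := h X
  rw [dist_self, mul_zero, Real.sinc_zero, abs_one] at hX
  filter_upwards [(tendsto_dist_left_cocompact_atTop X).eventually_ge_atTop (2 / k)] with Y hY
  have h2 : 2 ≤ k * dist X Y := by rwa [div_le_iff₀' hk] at hY
  have := abs_sinc_le_of_two_le h2
  linarith [(abs_le.mp (h Y)).2, (abs_le.mp hX).1]

/-- Two errors give `|sinc| ≥ 1 - 2e ≥ 3/4` at `Z`, which excludes arguments beyond `2`; then `x² /
40 ≤ 2e`. -/
theorem dist_sq_le_of_abs_sub_sinc_le (F : Space3 → ℝ) (X Z : Space3) (k e : ℝ)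
    (hk : 0 < k) (he : e ≤ 1 / 8) (h : ∀ Y, |F Y - (|Real.sinc (k * dist X Y)|)| ≤ e)
    (hZ : F X ≤ F Z) : (k * dist Z X) ^ 2 ≤ 80 * e := by
  have hX := h X
  rw [dist_self, mul_zero, Real.sinc_zero, abs_one] at hX
  have hsinc : 1 - 2 * e ≤ |Real.sinc (k * dist X Z)| := by
    linarith [(abs_le.mp (h Z)).2, (abs_le.mp hX).1]
  have hlt : k * dist X Z ≤ 2 := by
    by_contra hgt
    push Not at hgt
    linarith [abs_sinc_le_of_two_le hgt.le]
  rw [dist_comm Z X]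
  linarith [abs_sinc_le_of_le_two (by positivity) hlt]

/-! ### The corollary on pilot sequences. -/

theorem mainTheorem10 (κ : ℝ) :
    ∃ C δ : ℝ, 0 < C ∧ 0 < δ ∧
      ∀ (lam r0 : ℝ), 0 < lam → 0 < r0 →
      ∀ (U L : ℕ), U ≤ L →
      ∀ (X : Fin U → Space3), (∀ u, ‖X u‖ ≤ κ * lam) → (⨆ u, ‖X u‖ / r0) ≤ δ →
      ∀ (s : Fin U → EuclideanSpace ℂ (Fin L)), Orthonormal ℂ s →
      ∀ (Ω : Type*) [MeasurableSpace Ω] (P : Measure Ω) [IsProbabilityMeasure P]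
        (σ2 : NNReal) (z : Fin L → Space3 → Ω → ℂ), (∀ t, IsSpatiallyWhite P r0 σ2 (z t)) →
      ∀ᵐ ω ∂P, ∀ q : Fin L → Space3 → ℂ,
        (q = fun t => trainingSignal lam X (fun u => s u t) (fun A => z t A ω)) →
        -- the Laplace coefficients of the received signals exist
        (∀ t, ∀ ℓ : ℕ, ∀ m ∈ Finset.Icc (-(ℓ : ℤ)) ℓ,
          Tendsto (sphereRiemannSum (laplaceIntegrand r0 (q t) ℓ m)) atTop
            (𝓝 (laplaceCoeff r0 (q t) ℓ m))) ∧
        ∀ u : Fin U,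
          -- the series in the definition of the profile converges
          (∀ Y : Space3, Summable (profileTerm lam Y (combinedCoeff r0 (s u) q))) ∧
          -- the profile is approximately equal to the single-user profile
          (∀ Y : Space3,
            |profile lam r0 (combinedCoeff r0 (s u) q) Y
                - (|Real.sinc (2 * Real.pi / lam * dist (X u) Y)|)|
              ≤ C * ⨆ k, ‖X k‖ / r0) ∧
          -- location estimation by the peak of the profile is almost perfect
          (∃ Z : Space3, ∀ Y : Space3,
            profile lam r0 (combinedCoeff r0 (s u) q) Y
              ≤ profile lam r0 (combinedCoeff r0 (s u) q) Z) ∧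
          (∀ Z : Space3,
            profile lam r0 (combinedCoeff r0 (s u) q) (X u)
              ≤ profile lam r0 (combinedCoeff r0 (s u) q) Z →
            dist Z (X u) ≤ C * lam * √(⨆ k, ‖X k‖ / r0)) := by
  have hpi := Real.pi_pos
  set C₁ : ℝ := 2 + 2 * Real.pi * |κ| with hC₁
  have hC₁2 : 2 ≤ C₁ := by
    have : 0 ≤ 2 * Real.pi * |κ| := by positivity
    linarith
  have hC : 0 < 80 * C₁ := by linarith
  -- This `δ` forces `C₁ ε ≤ 1/80`, which covers both `ε ≤ 1/2` for the far field and `C₁ ε ≤ 1/8`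
  -- for the peak.
  refine ⟨80 * C₁, 1 / (80 * C₁), hC, by positivity, ?_⟩
  intro lam r0 hlam hr0 U L _ X hX hε s hs Ω _ P _ σ2 z hz
  set ε : ℝ := ⨆ u, ‖X u‖ / r0 with hεdef
  have hXε : ∀ u, ‖X u‖ / r0 ≤ ε := fun u =>
    le_ciSup (f := fun u => ‖X u‖ / r0) (Set.finite_range _).bddAbove u
  have hε80 : 80 * (C₁ * ε) ≤ 1 := by
    rw [le_div_iff₀ hC] at hε
    linarith
  -- With no users the supremum takes its default value `0`.
  have hε0 : 0 ≤ ε := Real.iSup_nonneg fun u => by positivity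
  have hεhalf : ε ≤ 1 / 2 := by nlinarith
  have hXhalf : ∀ u, ‖X u‖ ≤ r0 / 2 := fun u => by
    have := (hXε u).trans hεhalf
    rw [div_le_iff₀ hr0] at this
    linarith
  have hk : 0 < 2 * Real.pi / lam := by positivity
  filter_upwards [ae_tendsto_noise P r0 hr0 σ2 z hz] with ω hω
  rintro q rfl
  refine ⟨fun t ℓ m hm => ?_, fun u => ?_⟩
  · rw [Finset.mem_Icc] at hm
    obtain ⟨n, rfl⟩ : ∃ n : ℕ, m = (n : ℤ) - ℓ := ⟨(m + ℓ).toNat, by omega⟩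
    have h := tendsto_sphereRiemannSum_training lam r0 hr0 X hXhalf (fun u => s u t)
      (fun A => z t A ω) ℓ n (hω t ℓ n)
    rw [laplaceCoeff, h.limUnder_eq]
    exact h
  set Q := combinedCoeff r0 (s u)
    (fun t => trainingSignal lam X (fun u => s u t) (fun A => z t A ω)) with hQdef
  have hQ : ∀ ℓ n : ℕ, n ≤ 2 * ℓ → Q ℓ ((n : ℤ) - ℓ) = ((lam / √(4 * Real.pi) : ℝ) : ℂ) *
      ((1 / (√(4 * Real.pi) * r0) : ℝ) : ℂ) * nearFieldCoeff lam r0 (X u) ℓ n := fun ℓ n _ =>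
    combinedCoeff_training lam r0 hr0 X hXhalf s hs (fun t A => z t A ω) ℓ n
      (fun t => hω t ℓ n) u
  have hprof : ∀ Y, profile lam r0 Q Y = 1 / (4 * Real.pi) * ‖fieldCorrelation lam r0 (X u) Y‖ :=
    profile_eq lam r0 hlam hr0 (X u) (hXhalf u) Q hQ
  have happrox : ∀ Y, |profile lam r0 Q Y - (|Real.sinc (2 * Real.pi / lam * dist (X u) Y)|)| ≤
      C₁ * ε := fun Y => by
    rw [hprof]
    exact abs_norm_fieldCorrelation_sub_le lam r0 κ ε hlam hr0 (X u) (hX u) (hXε u) hεhalf Y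
  have hcont : Continuous (profile lam r0 Q) := by
    rw [funext hprof]
    exact continuous_const.mul (continuous_fieldCorrelation lam r0 hr0 (X u) (hXhalf u)).norm
  have he8 : C₁ * ε ≤ 1 / 8 := by linarith
  refine ⟨fun Y => (hasSum_profileTerm lam r0 hlam hr0 (X u) (hXhalf u) _ Q hQ Y).summable,
    fun Y => (happrox Y).trans ?_,
    exists_max_of_abs_sub_sinc_le _ hcont (X u) _ _ hk he8 happrox, fun Z hZ => ?_⟩
  · rw [mul_assoc]
    have : 0 ≤ C₁ * ε := by positivity
    linarith
  · have h := dist_sq_le_of_abs_sub_sinc_le _ (X u) Z _ _ hk he8 happrox hZ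
    -- From `(2π/λ)² d² ≤ 80 C₁ ε`, discarding `(2π)² ≥ 1` and using `80 C₁ ≤ (80 C₁)²`.
    have hd : (dist Z (X u)) ^ 2 ≤ (80 * C₁ * lam * √ε) ^ 2 := by
      rw [mul_pow, mul_pow, Real.sq_sqrt hε0]
      rw [mul_pow, div_pow, div_mul_eq_mul_div, div_le_iff₀ (by positivity)] at h
      have h1 : (dist Z (X u)) ^ 2 ≤ (2 * Real.pi) ^ 2 * dist Z (X u) ^ 2 :=
        le_mul_of_one_le_left (sq_nonneg _) (by nlinarith [Real.pi_gt_three])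
      refine (h1.trans h).trans ?_
      have h2 : 80 * (C₁ * ε) * lam ^ 2 = 80 * C₁ * (lam ^ 2 * ε) := by ring
      rw [h2, mul_assoc ((80 * C₁) ^ 2)]
      have h3 : 80 * C₁ ≤ (80 * C₁) ^ 2 := by nlinarith
      gcongr
    exact (sq_le_sq₀ dist_nonneg (by positivity)).mp hd
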